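/- **Setting.** Let $\mathcal X\subseteq\mathbb R^d$ be a closed convex set with $\|x-y\|\le D$ for all $x,y\in\mathcal X$, where $D>0$, and let $g:\mathbb R^d\to\mathbb R$ be convex, and Lipschitz on $\mathcal X$. Let $\varphi=g$ on $\mathcal X$ and $\varphi=+\infty$ off $\mathcal X$, and for $\alpha>0$ let $\varphi_\alpha(x)=\min_y\{\varphi(y)+\frac1{2\alpha}\|y-x\|^2\}$ be the Moreau envelope. The function $g$ is accessed through a stochastic subgradient oracle: $P$ is a probability measure, $U\supseteq\mathcal X$ is open, $G(x,\xi)\in\mathbb R^d$ is jointly measurable in $x\in U$ and the sample $\xi$, for every $x\in U$ the expectation $\mathbb E_{\xi\sim P}\,G(x,\xi)$ exists and lies in the convex subdifferential $\partial g(x)$, and $\mathbb E_{\xi\sim P}\|G(x,\xi)\|^2\le L^2$ for every $x\in\mathcal X$, where $L\ge 0$. Every oracle call uses a fresh member of an i.i.d. sequence of samples with law $P$. **Algorithms.** 1. $\mathrm{PSSM}(x_0,\mu,G,T)$: for $t=0,\dots,T-2$ set $x_{t+1}=\mathrm{proj}_{\mathcal X}\bigl(x_t-\frac{2}{\mu(t+1)}G(x_t,\xi)\bigr)$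 with a fresh sample $\xi$; return $\frac{2}{T(T+1)}\sum_{t=0}^{T-1}(t+1)x_t$. 2. $\mathrm{GR}(x_0,\mu,\lambda,T,I,G)$: put $\mu_i=2^i\mu$, $G^{(0)}=G$, $\hat x_0=x_0$. For $i=0,\dots,I$ set $\hat x_{i+1}=\mathrm{PSSM}(\hat x_i,\sum_{j=0}^i\mu_j,G^{(i)},T)$ and $G^{(i+1)}(x,\xi)=G^{(i)}(x,\xi)+\mu_{i+1}(x-\hat x_{i+1})$. Return $\frac{1}{\lambda+\sum_{i=1}^I\mu_i}\bigl(\lambda\hat x_{I+1}+\sum_{i=1}^I\mu_i\hat x_i\bigr)$. 3. $\mathcal A(x_c,\mu,\lambda,T,I,G)$, for $x_c\in\mathcal X$: put $\hat G(x,\xi)=G(x,\xi)+\mu(x-x_c)$ and $\bar x=\mathrm{GR}(x_c,\mu,\lambda/2,T,I,\hat G)$; return $\bar z=\frac{\mu}{\mu+\lambda}x_c+\frac{\lambda}{\mu+\lambda}\bar x$. **Theorem.** Let $\rho>0$. The envelope $\varphi_{1/(2\rho)}$ is finite and differentiable on $\mathbb R^d$, and the following hold. (a) Let $0<\varepsilon\le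 2\rho D$, $\mu=\frac{\varepsilon}{2D}$, $\lambda=2\rho-\frac{\varepsilon}{2D}$, and suppose that $I=\log_2\bigl(\frac34+\frac{\rho D}{\varepsilon}\bigr)$ is an integer. Then for every integer $T>0$ and every $x_c\in\mathcal X$, the point $\bar z=\mathcal A(x_c,\mu,\lambda,T,I,G)$ lies in $\mathcal X$ and $$\mathbb E\|\nabla\varphi_{1/(2\rho)}(\bar z)\|\le\frac{28\sqrt2\,\log_2\bigl(\frac34+\frac{\rho D}{\varepsilon}\bigr)\sqrt{2L^2+3\rho^2D^2}}{\sqrt{T+1}}+\frac\varepsilon2 .$$ (b) There is a universal constant $C$ (independent of all data, including $d,L,D,\rho,\varepsilon$) such that for every $0<\varepsilon\le\frac45\rho D$ there are an $\varepsilon'\in(0,\varepsilon]$ for which $I=\log_2\bigl(\frac34+\frac{\rho D}{\varepsilon'}\bigr)$ is an integer, and an integer $T>0$, both chosen from $L,D,\rho,\varepsilon$ only, such that for every problem and oracle as above and every $x_c\in\mathcal X$, the algorithm $\mathcal A$ with $\mu=\frac{\varepsilon'}{2D}$, $\lambda=2\rho-\frac{\varepsilon'}{2D}$ and these $I,T$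 returns $\bar z\in\mathcal X$ with $\mathbb E\|\nabla\varphi_{1/(2\rho)}(\bar z)\|\le\varepsilon$ after a total of at most $$C\,\frac{\log^3\bigl(\frac{\rho D}{\varepsilon}\bigr)\,(L^2+\rho^2D^2)}{\varepsilon^2}$$ calls to $\mathrm{proj}_{\mathcal X}$ and to the stochastic subgradient oracle. If $\log_2\bigl(\frac34+\frac{\rho D}{\varepsilon}\bigr)$ is itself an integer, then $\varepsilon'=\varepsilon$. -/

import Mathlib

open MeasureTheory ProbabilityTheory

namespace GradReg

noncomputable section

/-! ### Convex-analytic notions -/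

/-- The nearest-point map of a set `X`. -/
def nearestPoint {E : Type*} [NormedAddCommGroup E] (X : Set E) (x : E) : E :=
  Classical.epsilon fun y => y ∈ X ∧ ∀ z ∈ X, ‖x - y‖ ≤ ‖x - z‖

theorem nearestPoint_spec {E : Type*} [NormedAddCommGroup E] [ProperSpace E] {X : Set E}
    (hX : IsClosed X) (hne : X.Nonempty) (x : E) :
    nearestPoint X x ∈ X ∧ ∀ z ∈ X, ‖x - nearestPoint X x‖ ≤ ‖x - z‖ := by
  obtain ⟨y, hy, hxy⟩ := hX.exists_infDist_eq_dist hne x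
  refine Classical.epsilon_spec
    (p := fun y => y ∈ X ∧ ∀ z ∈ X, ‖x - y‖ ≤ ‖x - z‖) ⟨y, hy, fun z hz => ?_⟩
  rw [← dist_eq_norm, ← dist_eq_norm, ← hxy]
  exact Metric.infDist_le_dist_of_mem hz

/-- The convex subdifferential of `g : ℝ^d → ℝ` at `x`. -/
def subdifferential {d : ℕ} (g : EuclideanSpace ℝ (Fin d) → ℝ) (x : EuclideanSpace ℝ (Fin d)) :
    Set (EuclideanSpace ℝ (Fin d)) :=
  {v | ∀ y, g x + inner ℝ v (y - x) ≤ g y}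

open Classical in
/-- The extended-valued objective `φ`, equal to `g` on `X` and to `+∞` off `X`. -/
def objective {d : ℕ} (X : Set (EuclideanSpace ℝ (Fin d))) (g : EuclideanSpace ℝ (Fin d) → ℝ)
    (x : EuclideanSpace ℝ (Fin d)) : EReal :=
  if x ∈ X then (g x : EReal) else ⊤

/-- The Moreau envelope `f_λ(x) = inf_y { f(y) + (1/(2λ)) ‖y - x‖² }` of an extended-valued `f`. -/
def moreauEnvelope {d : ℕ} (f : EuclideanSpace ℝ (Fin d) → EReal) (lam : ℝ)
    (x : EuclideanSpace ℝ (Fin d)) : EReal :=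
  ⨅ y, f y + ((1 / (2 * lam) * ‖y - x‖ ^ 2 : ℝ) : EReal)

/-- The Moreau envelope as a real-valued function (meaningful where it is finite). -/
def moreauReal {d : ℕ} (f : EuclideanSpace ℝ (Fin d) → EReal) (lam : ℝ)
    (x : EuclideanSpace ℝ (Fin d)) : ℝ :=
  (moreauEnvelope f lam x).toReal

/-- The stationarity measure `‖∇ φ_{1/(2ρ)}(x)‖`. -/
def stationarity {d : ℕ} (ρ : ℝ) (X : Set (EuclideanSpace ℝ (Fin d)))
    (g : EuclideanSpace ℝ (Fin d) → ℝ) (x : EuclideanSpace ℝ (Fin d)) : ℝ :=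
  ‖gradient (moreauReal (objective X g) (1 / (2 * ρ))) x‖

/-! ### The algorithms

They act on one realization `ξ : ℕ → S` of the stream of samples. Every oracle call draws the next
unused sample, so the running number of oracle calls is also the index of the next sample. -/

/-- Current point of a run, together with the number of calls made so far to the stochastic
subgradient oracle and to the nearest-point map. -/
structure RunState (E : Type*) where
  point : E
  oracleCalls : ℕ
  projCalls : ℕ

/-- One step `x_{t+1} = proj_X (x_t - 2 / (μ (t + 1)) G(x_t, ξ_t))`, with a fresh sample. -/
def pssmStep {E S : Type*} [NormedAddCommGroup E] [NormedSpace ℝ E] (X : Set E) (ξ : ℕ → S)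
    (μ : ℝ) (G : E → S → E) (t : ℕ) (s : RunState E) : RunState E where
  point := nearestPoint X (s.point - (2 / (μ * ((t : ℝ) + 1))) • G s.point (ξ s.oracleCalls))
  oracleCalls := s.oracleCalls + 1
  projCalls := s.projCalls + 1

/-- The iterates of the projected stochastic subgradient method started at `s`. -/
def pssmIter {E S : Type*} [NormedAddCommGroup E] [NormedSpace ℝ E] (X : Set E) (ξ : ℕ → S)
    (μ : ℝ) (G : E → S → E) (s : RunState E) : ℕ → RunState E
  | 0 => s
  | t + 1 => pssmStep X ξ μ G t (pssmIter X ξ μ G s t)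

/-- The projected stochastic subgradient method for strongly convex functions: it performs the
steps `t = 0, …, T - 2` and returns the average `2 / (T (T + 1)) ∑_{t < T} (t + 1) x_t`. -/
def pssm {E S : Type*} [NormedAddCommGroup E] [NormedSpace ℝ E] (X : Set E) (ξ : ℕ → S)
    (s : RunState E) (μ : ℝ) (G : E → S → E) (T : ℕ) : RunState E where
  point := (2 / ((T : ℝ) * ((T : ℝ) + 1))) •
    ∑ t ∈ Finset.range T, ((t : ℝ) + 1) • (pssmIter X ξ μ G s t).point
  oracleCalls := (pssmIter X ξ μ G s (T - 1)).oracleCalls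
  projCalls := (pssmIter X ξ μ G s (T - 1)).projCalls

/-- The weights `μ_i = 2^i μ`. -/
def weight (μ : ℝ) (i : ℕ) : ℝ := μ * 2 ^ i

/-- State of gradual regularization after `i` outer rounds: the run state, whose point is the
center `x̂_i`, and the current perturbed oracle `G^{(i)}`. -/
def gradualState {E S : Type*} [NormedAddCommGroup E] [NormedSpace ℝ E] (X : Set E) (ξ : ℕ → S)
    (s : RunState E) (μ : ℝ) (T : ℕ) (G : E → S → E) : ℕ → RunState E × (E → S → E)
  | 0 => (s, G)
  | i + 1 =>
    let prev := gradualState X ξ s μ T G i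
    let next := pssm X ξ prev.1 (∑ j ∈ Finset.range (i + 1), weight μ j) prev.2 T
    (next, fun x w => prev.2 x w + weight μ (i + 1) • (x - next.point))

/-- Gradual regularization for strongly convex problems: the outer rounds `i = 0, …, I` produce
`x̂_1, …, x̂_{I+1}`, and a weighted average of these points is returned. -/
def gradualReg {E S : Type*} [NormedAddCommGroup E] [NormedSpace ℝ E] (X : Set E) (ξ : ℕ → S)
    (s : RunState E) (μ lam : ℝ) (T I : ℕ) (G : E → S → E) : RunState E where
  point := (1 / (lam + ∑ i ∈ Finset.Icc 1 I, weight μ i)) •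
    (lam • (gradualState X ξ s μ T G (I + 1)).1.point +
      ∑ i ∈ Finset.Icc 1 I, weight μ i • (gradualState X ξ s μ T G i).1.point)
  oracleCalls := (gradualState X ξ s μ T G (I + 1)).1.oracleCalls
  projCalls := (gradualState X ξ s μ T G (I + 1)).1.projCalls

/-- Gradual regularization for convex problems that need not be strongly convex: run gradual
regularization from `xc`, with averaging parameter `λ / 2`, on the oracle
`G(x, ξ) + μ (x - xc)` of the quadratically regularized problem, and average the result
with `xc`. -/
def convexGradualReg {E S : Type*} [NormedAddCommGroup E] [NormedSpace ℝ E] (X : Set E)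
    (ξ : ℕ → S) (xc : E) (μ lam : ℝ) (T I : ℕ) (G : E → S → E) : RunState E :=
  let r := gradualReg X ξ ⟨xc, 0, 0⟩ μ (lam / 2) T I (fun x w => G x w + μ • (x - xc))
  { point := (μ / (μ + lam)) • xc + (lam / (μ + lam)) • r.point
    oracleCalls := r.oracleCalls
    projCalls := r.projCalls }

/-! ### The problem class -/

/-- The standing assumptions: a convex `g`, Lipschitz on the closed convex set `X`, whose diameter
is at most `D`; a stochastic subgradient oracle `G` for `g`, defined and jointly measurable on an
open neighborhood `U` of `X` (its values off `U` are irrelevant), with second moment at most `L²`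
on `X`; and i.i.d. samples `ξ 0, ξ 1, …` with law `P`. -/
structure StandingAssumptions {d : ℕ} {S Ω : Type*} [MeasurableSpace S] [MeasurableSpace Ω]
    (X : Set (EuclideanSpace ℝ (Fin d))) (g : EuclideanSpace ℝ (Fin d) → ℝ) (P : Measure S)
    (U : Set (EuclideanSpace ℝ (Fin d)))
    (G : EuclideanSpace ℝ (Fin d) → S → EuclideanSpace ℝ (Fin d)) (L D : ℝ)
    (Pr : Measure Ω) (ξ : ℕ → Ω → S) : Prop where
  isClosed : IsClosed X
  convex : Convex ℝ X
  diam_le : ∀ x ∈ X, ∀ y ∈ X, ‖x - y‖ ≤ D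
  convexOn : ConvexOn ℝ Set.univ g
  lipschitz : ∃ K, LipschitzOnWith K g X
  sample_measurable : ∀ n, Measurable (ξ n)
  sample_indep : iIndepFun ξ Pr
  sample_law : ∀ n, Pr.map (ξ n) = P
  isOpen : IsOpen U
  subset : X ⊆ U
  oracle_measurable : Measurable fun p : U × S => G p.1 p.2
  oracle_integrable : ∀ x ∈ U, Integrable (G x) P
  oracle_mean : ∀ x ∈ U, ∫ w, G x w ∂P ∈ subdifferential g x
  oracle_sq_integrable : ∀ x ∈ X, Integrable (fun w => ‖G x w‖ ^ 2) P
  oracle_second_moment : ∀ x ∈ X, ∫ w, ‖G x w‖ ^ 2 ∂P ≤ L ^ 2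

end

end GradReg

/-! If `y` is the minimizer over `X` of `g + ρ‖· - z‖²`, the envelope has gradient `2ρ(z - y)` at
`z` (`hasGradientAt_moreauReal`), so the distance from the output to its proximal point has to be
controlled.

The oracle of round `i` is `G` plus the gradient of one quadratic, of weight `M_i = μ_0 + ⋯ + μ_i`
and centered at the weighted mean of `x̂_0, …, x̂_i` (`gradualState_oracle`). Each round thus
approximates a proximal point `x*_i`. With `λ/2 = μ_1 + ⋯ + μ_I`, the output `z` is the mean
obtained by adding `x̂_{I+1}` with weight `λ/2`, and the total weight is `2ρ`. Hence `2ρ(z - y)` is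
the sum of `μ_i(x̂_i - y)` over `i ≤ I` and of `(λ/2)(x̂_{I+1} - y)`. The term `i = 0` is at most
`μD = ε/2`.

For the other terms, adding a quadratic centered at `x̂_{i+1}` moves the minimizer by at most `δ_i =
‖x̂_{i+1} - x*_i‖` and not away from `x̂_{i+1}` (`IsProx.add_quadratic`). Since the weights double,
round `i` costs at most `2 M_i δ_i` (`sum_weight_mul_norm_sub_le`, `norm_smul_sub_prox_le`). The
stochastic method gives `E δ_i ≤ 2√(2L² + 2M_i²D²) / (M_i √(T+1))`. The factor `M_i` cancels, so all
rounds have comparable bounds and the number of rounds, logarithmic in `ρD/ε`, enters only as a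
factor.

The subproblems are random, but their centers and minimizers are functions of past samples, so a
fresh sample is independent of them and the oracle noise averages out (`integral_fresh_sample`). -/

namespace GradReg

/-! ### Proximal points -/

section Prox

variable {V : Type*} [NormedAddCommGroup V]

/-- `p` minimizes `g + M / 2 ‖· - c‖²` on `X`. -/
def IsProx (X : Set V) (g : V → ℝ) (M : ℝ) (c p : V) : Prop :=
  p ∈ X ∧ ∀ x ∈ X, g p + M / 2 * ‖p - c‖ ^ 2 ≤ g x + M / 2 * ‖x - c‖ ^ 2

variable {X : Set V} {g : V → ℝ} {M m : ℝ} {c c' p p' x y u : V}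

theorem exists_isProx [ProperSpace V] {D : ℝ} (hX : IsClosed X) (hne : X.Nonempty)
    (hD : ∀ x ∈ X, ∀ y ∈ X, ‖x - y‖ ≤ D) (hg : ContinuousOn g X) (M : ℝ) (c : V) :
    ∃ p, IsProx X g M c p := by
  have hbd : Bornology.IsBounded X :=
    Metric.isBounded_iff.2 ⟨D, fun x hx y hy => by rw [dist_eq_norm]; exact hD x hx y hy⟩
  have hcont : ContinuousOn (fun x => g x + M / 2 * ‖x - c‖ ^ 2) X :=
    hg.add (Continuous.continuousOn (by fun_prop))
  obtain ⟨p, hp, hmin⟩ :=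
    (Metric.isCompact_of_isClosed_isBounded hX hbd).exists_isMinOn hne hcont
  exact ⟨p, hp, fun x hx => hmin hx⟩

/-- Projection is the proximal map of the zero function, so its nonexpansiveness and continuity are
special cases of the proximal ones. -/
theorem isProx_nearestPoint [ProperSpace V] (hX : IsClosed X) (hne : X.Nonempty) (c : V) :
    IsProx X (fun _ => 0) 1 c (nearestPoint X c) := by
  obtain ⟨h1, h2⟩ := nearestPoint_spec hX hne c
  refine ⟨h1, fun x hx => ?_⟩
  have := h2 x hx
  rw [norm_sub_rev c, norm_sub_rev c] at this
  gcongr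

theorem isProx_self (hx : x ∈ X) : IsProx X (fun _ => 0) 1 x x :=
  ⟨hx, fun y _ => by simp⟩

variable [InnerProductSpace ℝ V]

/-- First-order optimality without derivatives: compare `p` with the point at parameter `s` on the
segment to `x`, where convexity bounds `g`. All later proximal estimates rest on this inequality. -/
theorem IsProx.inner_le (hg : ConvexOn ℝ X g) (h : IsProx X g M c p)
    (hM : 0 ≤ M) (hx : x ∈ X) : M * inner ℝ (c - p) (x - p) ≤ g x - g p := by
  by_contra! hlt
  set A := g x - g p - M * inner ℝ (c - p) (x - p) with hA
  set B := M / 2 * ‖x - p‖ ^ 2 with hB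
  have hA0 : A < 0 := by linarith
  have hB0 : 0 ≤ B := by positivity
  -- This `s` makes `A + s * B = s * A < 0`, whereas minimality of `p` forces `0 ≤ A + s * B`.
  obtain ⟨s, hs⟩ : ∃ s, s = -A / (-A + B) := ⟨_, rfl⟩
  have hs0 : 0 < s := hs ▸ div_pos (by linarith) (by linarith)
  have hs1 : s ≤ 1 := hs ▸ (div_le_one (by linarith)).2 (by linarith)
  have hsm : s * (-A + B) = -A := by
    rw [hs]; exact div_mul_cancel₀ _ (by linarith)
  have hmem := hg.1 h.1 hx (sub_nonneg.2 hs1) hs0.le (sub_add_cancel 1 s)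
  have hconv := hg.2 h.1 hx (sub_nonneg.2 hs1) hs0.le (sub_add_cancel 1 s)
  have hmin := h.2 _ hmem
  have heq : (1 - s) • p + s • x - c = s • (x - p) - (c - p) := by module
  have hnorm : ‖(1 - s) • p + s • x - c‖ ^ 2
      = s ^ 2 * ‖x - p‖ ^ 2 - 2 * s * inner ℝ (c - p) (x - p) + ‖p - c‖ ^ 2 := by
    rw [heq, norm_sub_sq_real, norm_smul, inner_smul_left, real_inner_comm, norm_sub_rev c p,
      mul_pow, Real.norm_eq_abs, sq_abs]
    simp; ring
  rw [hnorm] at hmin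
  simp only [smul_eq_mul] at hconv
  have h1 : 0 ≤ s * (A + s * B) := by rw [hA, hB]; nlinarith
  have h2 : 0 ≤ A + s * B := nonneg_of_mul_nonneg_right h1 hs0
  nlinarith

/-- Firm nonexpansiveness: test each optimality condition at the other minimizer and add; the values
of `g` cancel. -/
theorem IsProx.norm_sub_sq_le (hg : ConvexOn ℝ X g) (hM : 0 < M)
    (h : IsProx X g M c p) (h' : IsProx X g M c' p') :
    ‖p - p'‖ ^ 2 ≤ inner ℝ (c - c') (p - p') := by
  have h1 := h.inner_le hg hM.le h'.1
  have h2 := h'.inner_le hg hM.le h.1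
  have h3 : inner ℝ (c - p) (p' - p) + inner ℝ (c' - p') (p - p') ≤ 0 :=
    nonpos_of_mul_nonpos_right (by linarith) hM
  have e1 : p' - p = -(p - p') := by abel
  have e2 : c - p = (c - c') + (c' - p') - (p - p') := by abel
  rw [e1, inner_neg_right, e2, inner_sub_left, inner_add_left, real_inner_self_eq_norm_sq] at h3
  linarith

theorem IsProx.norm_sub_le (hg : ConvexOn ℝ X g) (hM : 0 < M)
    (h : IsProx X g M c p) (h' : IsProx X g M c' p') : ‖p - p'‖ ≤ ‖c - c'‖ := by
  have h1 := h.norm_sub_sq_le hg hM h'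
  have h2 := real_inner_le_norm (c - c') (p - p')
  rcases (norm_nonneg (p - p')).eq_or_lt with h0 | h0
  · rw [← h0]; exact norm_nonneg _
  · nlinarith

/-- Adding a quadratic centred at `u` moves the minimizer by at most its distance to `u`, and
towards `u`. -/
theorem IsProx.add_quadratic (hg : ConvexOn ℝ X g) (hM : 0 ≤ M) (hm : 0 < m)
    (h : IsProx X g M c p) (h' : IsProx X g (M + m) c' p')
    (hc : (M + m) • c' = M • c + m • u) : ‖p' - p‖ ≤ ‖u - p‖ ∧ ‖u - p'‖ ≤ ‖u - p‖ := by
  have h1 := h.inner_le hg hM h'.1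
  have h2 := h'.inner_le hg (by linarith) h.1
  have h3 : M * inner ℝ (c - p) (p' - p) + (M + m) * inner ℝ (c' - p') (p - p') ≤ 0 := by
    linarith
  have e1 : p - p' = -(p' - p) := by abel
  have e2 : (M + m) • (c' - p') = M • (c - p) - M • (p' - p) + m • (u - p') := by
    rw [smul_sub, hc]; module
  have h4 : (M + m) * inner ℝ (c' - p') (p' - p)
      = M * inner ℝ (c - p) (p' - p) - M * ‖p' - p‖ ^ 2 + m * inner ℝ (u - p') (p' - p) := by
    rw [← real_inner_smul_left, e2, inner_add_left, inner_sub_left, real_inner_smul_left,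
      real_inner_smul_left, real_inner_smul_left, real_inner_self_eq_norm_sq]
  rw [e1, inner_neg_right, mul_neg, h4] at h3
  -- The two optimality conditions leave an angle of at least 90° at `p'` between `u` and `p`;
  -- expanding `‖u - p‖²` at `p'` then gives both bounds.
  have h5 : 0 ≤ inner ℝ (u - p') (p' - p) := by
    have : 0 ≤ m * inner ℝ (u - p') (p' - p) := by nlinarith [mul_nonneg hM (sq_nonneg ‖p' - p‖)]
    exact nonneg_of_mul_nonneg_right this hm
  have h6 : ‖u - p‖ ^ 2 = ‖u - p'‖ ^ 2 + 2 * inner ℝ (u - p') (p' - p) + ‖p' - p‖ ^ 2 := by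
    rw [← norm_add_sq_real, sub_add_sub_cancel]
  constructor <;> refine le_of_sq_le_sq ?_ (norm_nonneg _) <;>
    nlinarith [sq_nonneg ‖u - p'‖, sq_nonneg ‖p' - p‖]

theorem norm_nearestPoint_sub_le [ProperSpace V] (hX : IsClosed X) (hconv : Convex ℝ X)
    (hx : x ∈ X) (c : V) : ‖nearestPoint X c - x‖ ≤ ‖c - x‖ :=
  (isProx_nearestPoint hX ⟨x, hx⟩ c).norm_sub_le (convexOn_const 0 hconv) one_pos (isProx_self hx)

theorem continuous_of_isProx (hg : ConvexOn ℝ X g) (hM : 0 < M) {P : V → V}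
    (hP : ∀ c, IsProx X g M c (P c)) : Continuous P := by
  refine LipschitzWith.continuous (K := 1) (LipschitzWith.of_dist_le_mul fun c c' => ?_)
  rw [dist_eq_norm, dist_eq_norm, NNReal.coe_one, one_mul]
  exact (hP c).norm_sub_le hg hM (hP c')

theorem continuous_nearestPoint [ProperSpace V] (hX : IsClosed X) (hne : X.Nonempty)
    (hconv : Convex ℝ X) : Continuous (nearestPoint X) :=
  continuous_of_isProx (convexOn_const 0 hconv) one_pos (isProx_nearestPoint hX hne)

end Prox

/-! ### The Moreau envelope -/

section Envelope

variable {d : ℕ} {X : Set (EuclideanSpace ℝ (Fin d))} {g : EuclideanSpace ℝ (Fin d) → ℝ} {ρ : ℝ}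
  {x p : EuclideanSpace ℝ (Fin d)} {P : EuclideanSpace ℝ (Fin d) → EuclideanSpace ℝ (Fin d)}

theorem moreauEnvelope_eq_of_isProx (hp : IsProx X g (2 * ρ) x p) :
    moreauEnvelope (objective X g) (1 / (2 * ρ)) x = ((g p + ρ * ‖p - x‖ ^ 2 : ℝ) : EReal) := by
  have hρ : 1 / (2 * (1 / (2 * ρ))) = ρ := by
    rcases eq_or_ne ρ 0 with rfl | h
    · simp
    · field_simp
  unfold moreauEnvelope
  rw [hρ]
  refine le_antisymm ((iInf_le _ p).trans_eq ?_) (le_iInf fun y => ?_)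
  · rw [objective, if_pos hp.1, EReal.coe_add]
  · by_cases hy : y ∈ X
    · rw [objective, if_pos hy, ← EReal.coe_add, EReal.coe_le_coe_iff]
      have := hp.2 y hy
      rwa [mul_div_cancel_left₀ _ two_ne_zero] at this
    · rw [objective, if_neg hy, EReal.top_add_coe]
      exact le_top

theorem moreauReal_eq_of_isProx (hp : IsProx X g (2 * ρ) x p) :
    moreauReal (objective X g) (1 / (2 * ρ)) x = g p + ρ * ‖p - x‖ ^ 2 := by
  rw [moreauReal, moreauEnvelope_eq_of_isProx hp, EReal.toReal_coe]

/-- The linearization error is at most `ρ‖y - x‖²` in absolute value. The upper bound uses `P x` as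
a competitor at `y`; the lower one uses `P y` as a competitor at `x`, together with nonexpansiveness
of `P`. -/
theorem hasGradientAt_moreauReal (hg : ConvexOn ℝ X g) (hρ : 0 < ρ)
    (hP : ∀ c, IsProx X g (2 * ρ) c (P c)) (x : EuclideanSpace ℝ (Fin d)) :
    HasGradientAt (moreauReal (objective X g) (1 / (2 * ρ))) ((2 * ρ) • (x - P x)) x := by
  rw [hasGradientAt_iff_isLittleO]
  refine Asymptotics.IsBigO.trans_isLittleO (g := fun y => ‖y - x‖ ^ 2)
    (Asymptotics.IsBigO.of_bound ρ (Filter.Eventually.of_forall fun y => ?_)) ?_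
  · rw [moreauReal_eq_of_isProx (hP y), moreauReal_eq_of_isProx (hP x), Real.norm_eq_abs,
      real_inner_smul_left, norm_pow, norm_norm]
    have h1 := (hP y).2 _ (hP x).1
    have h2 := (hP x).2 _ (hP y).1
    have h3 := (hP y).norm_sub_sq_le hg (by linarith) (hP x)
    rw [mul_div_cancel_left₀ _ two_ne_zero] at h1 h2
    have h4 := (hP y).norm_sub_le hg (by linarith) (hP x)
    have h5 := real_inner_le_norm (y - x) (P y - P x)
    have e1 : ‖P x - y‖ ^ 2
        = ‖P x - x‖ ^ 2 + 2 * inner ℝ (x - P x) (y - x) + ‖y - x‖ ^ 2 := by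
      rw [norm_sub_rev, norm_sub_rev (P x) x, ← norm_add_sq_real]; congr 2; abel
    have e2 : ‖P y - x‖ ^ 2
        = ‖P y - y‖ ^ 2 - 2 * inner ℝ (y - P y) (y - x) + ‖y - x‖ ^ 2 := by
      rw [norm_sub_rev, norm_sub_rev (P y) y, ← norm_sub_sq_real]; congr 2; abel
    have e3 : inner ℝ (y - P y) (y - x)
        = inner ℝ (x - P x) (y - x) + ‖y - x‖ ^ 2 - inner ℝ (y - x) (P y - P x) := by
      rw [← real_inner_self_eq_norm_sq, real_inner_comm (P y - P x), ← inner_add_left,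
        ← inner_sub_left]
      congr 1; abel
    have h6 : inner ℝ (y - x) (P y - P x) ≤ ‖y - x‖ ^ 2 := by nlinarith [norm_nonneg (y - x)]
    rw [e1] at h1
    rw [e2, e3] at h2
    rw [abs_le]
    constructor <;> nlinarith
  · exact (Asymptotics.isLittleO_norm_pow_id one_lt_two).comp_tendsto
      (tendsto_sub_nhds_zero_iff.2 Filter.tendsto_id)

theorem stationarity_eq (hg : ConvexOn ℝ X g) (hρ : 0 < ρ)
    (hP : ∀ c, IsProx X g (2 * ρ) c (P c)) (x : EuclideanSpace ℝ (Fin d)) :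
    stationarity ρ X g x = ‖(2 * ρ) • (x - P x)‖ := by
  rw [stationarity, (hasGradientAt_moreauReal hg hρ hP x).gradient]

end Envelope

/-! ### Fresh samples -/

section Past

variable {S Ω : Type*} [mS : MeasurableSpace S] {ξ : ℕ → Ω → S} {n m : ℕ}

/-- The `σ`-algebra generated by the samples `ξ 0, …, ξ (n - 1)`. -/
abbrev past (ξ : ℕ → Ω → S) (n : ℕ) : MeasurableSpace Ω :=
  ⨆ k ∈ Set.Iio n, mS.comap (ξ k)

theorem past_mono (h : n ≤ m) : past ξ n ≤ past ξ m :=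
  biSup_mono fun _ hk => lt_of_lt_of_le hk h

theorem measurable_sample_past (h : n < m) : Measurable[past ξ m] (ξ n) :=
  measurable_iff_comap_le.2 (le_biSup (fun k => mS.comap (ξ k)) (show n ∈ Set.Iio m from h))

theorem past_le [MeasurableSpace Ω] (hξ : ∀ n, Measurable (ξ n)) (n : ℕ) :
    past ξ n ≤ ‹MeasurableSpace Ω› :=
  iSup₂_le fun k _ => (hξ k).comap_le

theorem indepFun_of_measurable_past [MeasurableSpace Ω] {Pr : Measure Ω}
    (hξ : ∀ n, Measurable (ξ n)) (hind : iIndepFun ξ Pr) {α : Type*} [MeasurableSpace α]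
    {W : Ω → α} (hW : Measurable[past ξ n] W) : IndepFun W (ξ n) Pr := by
  have h := indep_iSup_of_disjoint (fun k => (hξ k).comap_le) hind
    (S := Set.Iio n) (T := {n}) (by simp)
  rw [iSup_singleton] at h
  exact (IndepFun_iff_Indep _ _ _).2 (indep_of_indep_of_le_left h (measurable_iff_comap_le.1 hW))

/-- Integrating out the next sample. -/
theorem integral_fresh_sample [MeasurableSpace Ω] {Pr : Measure Ω} [IsProbabilityMeasure Pr]
    {P : Measure S} [IsProbabilityMeasure P]
    (hξ : ∀ n, Measurable (ξ n)) (hind : iIndepFun ξ Pr) (hlaw : ∀ n, Pr.map (ξ n) = P)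
    {α : Type*} [MeasurableSpace α] {W : Ω → α} (hW : Measurable[past ξ n] W)
    {h : α × S → ℝ} (hm : Measurable h) {K : ℝ} (hi : ∀ a, Integrable (fun s => h (a, s)) P)
    (hb : ∀ a, ∫ s, ‖h (a, s)‖ ∂P ≤ K) :
    Integrable (fun ω => h (W ω, ξ n ω)) Pr ∧ Integrable (fun ω => ∫ s, h (W ω, s) ∂P) Pr ∧
      ∫ ω, h (W ω, ξ n ω) ∂Pr = ∫ ω, ∫ s, h (W ω, s) ∂P ∂Pr := by
  have hW' : Measurable W := hW.mono (past_le hξ n) le_rfl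
  have : IsProbabilityMeasure (Pr.map W) := Measure.isProbabilityMeasure_map hW'.aemeasurable
  have hpair : Measurable fun ω => (W ω, ξ n ω) := hW'.prodMk (hξ n)
  have hmap : Pr.map (fun ω => (W ω, ξ n ω)) = (Pr.map W).prod P := by
    rw [(indepFun_iff_map_prod_eq_prod_map_map hW'.aemeasurable (hξ n).aemeasurable).1
      (indepFun_of_measurable_past hξ hind hW), hlaw n]
  have hprod : Integrable h ((Pr.map W).prod P) := by
    refine (integrable_prod_iff hm.aestronglyMeasurable).2 ⟨Filter.Eventually.of_forall hi, ?_⟩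
    refine Integrable.of_bound
      (hm.norm.stronglyMeasurable.integral_prod_right').aestronglyMeasurable K
      (Filter.Eventually.of_forall fun a => ?_)
    rw [Real.norm_of_nonneg (integral_nonneg fun _ => norm_nonneg _)]
    exact hb a
  refine ⟨?_, ?_, ?_⟩
  · rw [← hmap] at hprod
    exact hprod.comp_measurable hpair
  · exact hprod.integral_prod_left.comp_measurable hW'
  · rw [← integral_map (f := h) hpair.aemeasurable hm.aestronglyMeasurable, hmap,
      integral_prod _ hprod, integral_map hW'.aemeasurable]
    exact hm.stronglyMeasurable.integral_prod_right'.aestronglyMeasurable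

end Past

/-! ### The projected stochastic subgradient method -/

theorem pssmIter_oracleCalls {E S : Type*} [NormedAddCommGroup E] [NormedSpace ℝ E] (X : Set E)
    (ξ : ℕ → S) (μ : ℝ) (G : E → S → E) (s : RunState E) (t : ℕ) :
    (pssmIter X ξ μ G s t).oracleCalls = s.oracleCalls + t := by
  induction t with
  | zero => rfl
  | succ t ih => simp only [pssmIter, pssmStep, ih]; ring

theorem pssmIter_projCalls {E S : Type*} [NormedAddCommGroup E] [NormedSpace ℝ E] (X : Set E)
    (ξ : ℕ → S) (μ : ℝ) (G : E → S → E) (s : RunState E) (t : ℕ) :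
    (pssmIter X ξ μ G s t).projCalls = s.projCalls + t := by
  induction t with
  | zero => rfl
  | succ t ih => simp only [pssmIter, pssmStep, ih]; ring

theorem sum_range_add_one (T : ℕ) :
    ∑ t ∈ Finset.range T, ((t : ℝ) + 1) = (T : ℝ) * ((T : ℝ) + 1) / 2 := by
  induction T with
  | zero => simp
  | succ T ih => rw [Finset.sum_range_succ, ih]; push_cast; ring

theorem pssm_point_eq_sum {E S : Type*} [NormedAddCommGroup E] [NormedSpace ℝ E] (X : Set E)
    (ξ : ℕ → S) (s : RunState E) (μ : ℝ) (G : E → S → E) (T : ℕ) :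
    (pssm X ξ s μ G T).point = ∑ t ∈ Finset.range T,
      (2 / ((T : ℝ) * ((T : ℝ) + 1)) * ((t : ℝ) + 1)) • (pssmIter X ξ μ G s t).point := by
  simp only [pssm, Finset.smul_sum, smul_smul]

theorem sum_pssm_weights {T : ℕ} (hT : 0 < T) :
    ∑ t ∈ Finset.range T, 2 / ((T : ℝ) * ((T : ℝ) + 1)) * ((t : ℝ) + 1) = 1 := by
  have : (0 : ℝ) < T := Nat.cast_pos.2 hT
  rw [← Finset.mul_sum, sum_range_add_one]
  field_simp

/-- Jensen's inequality for the squared norm; it passes from the iterates to their average. -/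
theorem norm_sub_sq_sum_le {E ι : Type*} [NormedAddCommGroup E] [NormedSpace ℝ E]
    {s : Finset ι} {w : ι → ℝ} {x : ι → E} (hw : ∀ i ∈ s, 0 ≤ w i) (h1 : ∑ i ∈ s, w i = 1)
    (p : E) : ‖∑ i ∈ s, w i • x i - p‖ ^ 2 ≤ ∑ i ∈ s, w i * ‖x i - p‖ ^ 2 := by
  have hconv : ConvexOn ℝ Set.univ fun y : E => ‖y‖ ^ 2 :=
    convexOn_univ_norm.pow (fun _ _ => norm_nonneg _) 2
  have h := hconv.map_sum_le (p := fun i => x i - p) hw h1 fun _ _ => Set.mem_univ _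
  simp only [smul_sub, Finset.sum_sub_distrib, ← Finset.sum_smul, h1, one_smul, smul_eq_mul] at h
  exact h

section PSSM

variable {d : ℕ} {S Ω : Type*} [MeasurableSpace S] [MeasurableSpace Ω]
  {X U : Set (EuclideanSpace ℝ (Fin d))} {g : EuclideanSpace ℝ (Fin d) → ℝ} {P : Measure S}
  {G : EuclideanSpace ℝ (Fin d) → S → EuclideanSpace ℝ (Fin d)} {L D M : ℝ}
  {Pr : Measure Ω} {ξ : ℕ → Ω → S} {n : ℕ}

namespace StandingAssumptions

theorem convexOn_set (A : StandingAssumptions X g P U G L D Pr ξ) : ConvexOn ℝ X g :=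
  A.convexOn.subset (Set.subset_univ X) A.convex

theorem exists_prox (A : StandingAssumptions X g P U G L D Pr ξ) (hne : X.Nonempty) (M : ℝ)
    (c : EuclideanSpace ℝ (Fin d)) : ∃ p, IsProx X g M c p := by
  obtain ⟨K, hK⟩ := A.lipschitz
  exact exists_isProx A.isClosed hne A.diam_le hK.continuousOn M c

theorem measurable_oracle (A : StandingAssumptions X g P U G L D Pr ξ) :
    Measurable fun p : X × S => G p.1 p.2 :=
  A.oracle_measurable.comp
    ((((measurable_subtype_coe.comp measurable_fst).subtype_mk
      (h := fun p : X × S => A.subset p.1.2)).prodMk measurable_snd))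

theorem measurable_oracle_comp (A : StandingAssumptions X g P U G L D Pr ξ) {Θ : Type*}
    {mΘ : MeasurableSpace Θ} {x : Θ → EuclideanSpace ℝ (Fin d)} {s : Θ → S} (hx : Measurable x)
    (hxX : ∀ θ, x θ ∈ X) (hs : Measurable s) : Measurable fun θ => G (x θ) (s θ) :=
  A.measurable_oracle.comp ((hx.subtype_mk (h := hxX)).prodMk hs)

theorem measurable_step (A : StandingAssumptions X g P U G L D Pr ξ) (hne : X.Nonempty)
    {Θ : Type*} {mΘ : MeasurableSpace Θ} {x c : Θ → EuclideanSpace ℝ (Fin d)} {s : Θ → S}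
    (hx : Measurable x) (hxX : ∀ θ, x θ ∈ X) (hc : Measurable c) (hs : Measurable s) (γ M : ℝ) :
    Measurable fun θ => nearestPoint X (x θ - γ • (G (x θ) (s θ) + M • (x θ - c θ))) := by
  have hG := A.measurable_oracle_comp hx hxX hs
  exact (continuous_nearestPoint A.isClosed hne A.convex).measurable.comp
    (hx.sub ((hG.add ((hx.sub hc).const_smul M)).const_smul γ))

variable [IsProbabilityMeasure P] [IsProbabilityMeasure Pr]

theorem integral_norm_sq_oracle_le (A : StandingAssumptions X g P U G L D Pr ξ)
    {x : Ω → EuclideanSpace ℝ (Fin d)} (hx : Measurable[past ξ n] x) (hxX : ∀ ω, x ω ∈ X) :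
    Integrable (fun ω => ‖G (x ω) (ξ n ω)‖ ^ 2) Pr ∧
      ∫ ω, ‖G (x ω) (ξ n ω)‖ ^ 2 ∂Pr ≤ L ^ 2 := by
  obtain ⟨h1, h2, h3⟩ := integral_fresh_sample (n := n) A.sample_measurable A.sample_indep
    A.sample_law (W := fun ω => (⟨x ω, hxX ω⟩ : X)) (hx.subtype_mk (h := hxX))
    (h := fun p => ‖G p.1 p.2‖ ^ 2) (A.measurable_oracle.norm.pow_const 2) (K := L ^ 2)
    (fun a => A.oracle_sq_integrable a a.2)
    (fun a => by simpa using A.oracle_second_moment a a.2)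
  refine ⟨h1, h3.trans_le ?_⟩
  calc _ ≤ ∫ _, L ^ 2 ∂Pr :=
        integral_mono h2 (integrable_const _) fun ω => A.oracle_second_moment _ (hxX ω)
    _ = L ^ 2 := by simp

theorem integral_inner_oracle (A : StandingAssumptions X g P U G L D Pr ξ)
    {x p : Ω → EuclideanSpace ℝ (Fin d)} (hx : Measurable[past ξ n] x)
    (hxX : ∀ ω, x ω ∈ X) (hp : Measurable[past ξ n] p) (hpX : ∀ ω, p ω ∈ X) :
    Integrable (fun ω => inner ℝ (G (x ω) (ξ n ω)) (x ω - p ω)) Pr ∧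
      Integrable (fun ω => inner ℝ (∫ w, G (x ω) w ∂P) (x ω - p ω)) Pr ∧
      ∫ ω, inner ℝ (G (x ω) (ξ n ω)) (x ω - p ω) ∂Pr =
        ∫ ω, inner ℝ (∫ w, G (x ω) w ∂P) (x ω - p ω) ∂Pr := by
  have hint : ∀ a : X × X, ∫ w, inner ℝ (G a.1 w) ((a.1 : EuclideanSpace ℝ (Fin d)) - a.2) ∂P
      = inner ℝ (∫ w, G a.1 w ∂P) ((a.1 : EuclideanSpace ℝ (Fin d)) - a.2) := fun a => by
    simp only [real_inner_comm ((a.1 : EuclideanSpace ℝ (Fin d)) - a.2)]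
    exact integral_inner (A.oracle_integrable _ (A.subset a.1.2)) _
  have hmeas : Measurable fun q : (X × X) × S =>
      inner ℝ (G q.1.1 q.2) ((q.1.1 : EuclideanSpace ℝ (Fin d)) - q.1.2) := by
    refine Measurable.inner ?_ (by fun_prop)
    exact A.measurable_oracle.comp
      ((measurable_fst.comp measurable_fst).prodMk measurable_snd)
  have hG : ∀ a : X × X, Integrable (fun w => inner ℝ (G a.1 w)
      ((a.1 : EuclideanSpace ℝ (Fin d)) - a.2)) P := fun a =>
    (A.oracle_integrable _ (A.subset a.1.2)).inner_const _
  have hsq : ∀ a : X, Integrable (fun w => 1 + ‖G a w‖ ^ 2) P := fun a =>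
    (integrable_const _).add (A.oracle_sq_integrable a a.2)
  obtain ⟨h1, h2, h3⟩ := integral_fresh_sample (n := n) A.sample_measurable A.sample_indep
    A.sample_law (W := fun ω => ((⟨x ω, hxX ω⟩ : X), (⟨p ω, hpX ω⟩ : X)))
    ((hx.subtype_mk (h := hxX)).prodMk (hp.subtype_mk (h := hpX))) hmeas
    -- Uniform bound from `‖G‖ ≤ 1 + ‖G‖²` and the diameter of `X`.
    (K := (1 + L ^ 2) * D) hG (fun a => by
      have hD := A.diam_le _ a.1.2 _ a.2.2
      calc _ ≤ ∫ w, (1 + ‖G a.1 w‖ ^ 2) * D ∂P := by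
            refine integral_mono (hG a).norm ((hsq a.1).mul_const _) fun w => ?_
            refine (norm_inner_le_norm _ _).trans ?_
            gcongr
            nlinarith [sq_nonneg (‖G a.1 w‖ - 1)]
        _ = (1 + ∫ w, ‖G a.1 w‖ ^ 2 ∂P) * D := by
            rw [integral_mul_const, integral_add (integrable_const _)
              (A.oracle_sq_integrable _ a.1.2)]
            simp
        _ ≤ _ := by
            have := (norm_nonneg _).trans hD
            gcongr
            exact A.oracle_second_moment _ a.1.2)
  refine ⟨h1, ?_, ?_⟩
  · exact h2.congr (Filter.Eventually.of_forall fun ω => hint (⟨x ω, hxX ω⟩, ⟨p ω, hpX ω⟩))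
  · exact h3.trans (integral_congr_ae
      (Filter.Eventually.of_forall fun ω => hint (⟨x ω, hxX ω⟩, ⟨p ω, hpX ω⟩)))

omit [IsProbabilityMeasure P] in
theorem integrable_norm_sub_pow (A : StandingAssumptions X g P U G L D Pr ξ)
    {x p : Ω → EuclideanSpace ℝ (Fin d)} (hx : Measurable x) (hxX : ∀ ω, x ω ∈ X)
    (hp : Measurable p) (hpX : ∀ ω, p ω ∈ X) (k : ℕ) :
    Integrable (fun ω => ‖x ω - p ω‖ ^ k) Pr :=
  Integrable.of_bound ((hx.sub hp).norm.pow_const k).aestronglyMeasurable (D ^ k)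
    (Filter.Eventually.of_forall fun ω => by
      rw [norm_pow, norm_norm]
      gcongr
      exact A.diam_le _ (hxX ω) _ (hpX ω))

/-- One projected step on the perturbed oracle, in expectation. -/
theorem integral_step_le (A : StandingAssumptions X g P U G L D Pr ξ) (hM : 0 < M)
    {x c p x' : Ω → EuclideanSpace ℝ (Fin d)} (hx : Measurable[past ξ n] x)
    (hxX : ∀ ω, x ω ∈ X) (hcX : ∀ ω, c ω ∈ X) (hp : Measurable[past ξ n] p)
    (hpc : ∀ ω, IsProx X g M (c ω) (p ω)) {γ : ℝ} (hγ : 0 ≤ γ)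
    (hx' : ∀ ω, x' ω = nearestPoint X (x ω - γ • (G (x ω) (ξ n ω) + M • (x ω - c ω))))
    (hx'm : Measurable x') :
    ∫ ω, ‖x' ω - p ω‖ ^ 2 ∂Pr ≤ (1 - 2 * γ * M) * ∫ ω, ‖x ω - p ω‖ ^ 2 ∂Pr +
      γ ^ 2 * (2 * L ^ 2 + 2 * M ^ 2 * D ^ 2) := by
  have hpX : ∀ ω, p ω ∈ X := fun ω => (hpc ω).1
  have hle := past_le A.sample_measurable n
  obtain ⟨i1, i2, i3⟩ := A.integral_inner_oracle hx hxX hp hpX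
  obtain ⟨j1, j2⟩ := A.integral_norm_sq_oracle_le hx hxX
  have ha := A.integrable_norm_sub_pow (hx.mono hle le_rfl) hxX (hp.mono hle le_rfl) hpX 2
  have hx'X : ∀ ω, x' ω ∈ X := fun ω => by
    rw [hx' ω]; exact (nearestPoint_spec A.isClosed ⟨_, hxX ω⟩ _).1
  have ha' := A.integrable_norm_sub_pow hx'm hx'X (hp.mono hle le_rfl) hpX 2
  -- The difference of inner products is the oracle noise, which has mean zero. The factor `1 - 2γM`
  -- needs no separate strong convexity: optimality of `p` bounds `M⟪c - p, x - p⟫` by `g x - g p`,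
  -- hence by the mean subgradient term, and `M‖x - p‖²` remains.
  have hpt : ∀ ω, ‖x' ω - p ω‖ ^ 2 ≤ ((1 - 2 * γ * M) * ‖x ω - p ω‖ ^ 2 -
      2 * γ * (inner ℝ (G (x ω) (ξ n ω)) (x ω - p ω) -
        inner ℝ (∫ w, G (x ω) w ∂P) (x ω - p ω))) +
      (γ ^ 2 * (2 * ‖G (x ω) (ξ n ω)‖ ^ 2) + γ ^ 2 * (2 * M ^ 2 * D ^ 2)) := fun ω => by
    set a := G (x ω) (ξ n ω)
    have h1 : ‖x' ω - p ω‖ ^ 2 ≤ ‖(x ω - p ω) - γ • (a + M • (x ω - c ω))‖ ^ 2 := by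
      have := norm_nearestPoint_sub_le A.isClosed A.convex (hpX ω)
        (x ω - γ • (a + M • (x ω - c ω)))
      rw [← hx' ω, sub_right_comm] at this
      gcongr
    have h2 := A.oracle_mean (x ω) (A.subset (hxX ω)) (p ω)
    have h3 := (hpc ω).inner_le A.convexOn_set hM.le (hxX ω)
    have e1 : p ω - x ω = -(x ω - p ω) := by abel
    rw [e1, inner_neg_right] at h2
    have h4 : inner ℝ (a + M • (x ω - c ω)) (x ω - p ω)
        = inner ℝ a (x ω - p ω) + M * ‖x ω - p ω‖ ^ 2
          - M * inner ℝ (c ω - p ω) (x ω - p ω) := by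
      have e2 : x ω - c ω = (x ω - p ω) - (c ω - p ω) := by abel
      rw [inner_add_left, real_inner_smul_left, e2, inner_sub_left, real_inner_self_eq_norm_sq]
      ring
    have h5 : ‖a + M • (x ω - c ω)‖ ^ 2 ≤ 2 * ‖a‖ ^ 2 + 2 * M ^ 2 * D ^ 2 := by
      have k1 : ‖a + M • (x ω - c ω)‖ ≤ ‖a‖ + M * D := by
        refine (norm_add_le _ _).trans ?_
        rw [norm_smul, Real.norm_of_nonneg hM.le]
        gcongr
        exact A.diam_le _ (hxX ω) _ (hcX ω)
      calc _ ≤ (‖a‖ + M * D) ^ 2 := by gcongr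
        _ ≤ _ := by nlinarith [sq_nonneg (‖a‖ - M * D)]
    rw [norm_sub_sq_real (x ω - p ω), real_inner_smul_right, real_inner_comm, h4, norm_smul,
      mul_pow, Real.norm_eq_abs, sq_abs] at h1
    have h6 := mul_le_mul_of_nonneg_left h5 (sq_nonneg γ)
    have h7 := mul_le_mul_of_nonneg_left (h3.trans (by linarith only [h2] :
      g (x ω) - g (p ω) ≤ inner ℝ (∫ w, G (x ω) w ∂P) (x ω - p ω))) hγ
    linarith
  have i4 : Integrable (fun ω => inner ℝ (G (x ω) (ξ n ω)) (x ω - p ω) -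
      inner ℝ (∫ w, G (x ω) w ∂P) (x ω - p ω)) Pr := i1.sub i2
  have k1 : Integrable (fun ω => (1 - 2 * γ * M) * ‖x ω - p ω‖ ^ 2 -
      2 * γ * (inner ℝ (G (x ω) (ξ n ω)) (x ω - p ω) -
        inner ℝ (∫ w, G (x ω) w ∂P) (x ω - p ω))) Pr :=
    (ha.const_mul _).sub (i4.const_mul _)
  have k2 : Integrable (fun ω => γ ^ 2 * (2 * ‖G (x ω) (ξ n ω)‖ ^ 2) +
      γ ^ 2 * (2 * M ^ 2 * D ^ 2)) Pr :=
    ((j1.const_mul 2).const_mul _).add (integrable_const _)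
  refine (integral_mono ha' (k1.add k2) hpt).trans ?_
  rw [integral_add' k1 k2, integral_sub (ha.const_mul _) (i4.const_mul _),
    integral_add ((j1.const_mul 2).const_mul _) (integrable_const _), integral_const_mul,
    integral_const_mul, integral_sub i1 i2, i3, integral_const_mul, integral_const_mul]
  simp only [sub_self, mul_zero, sub_zero, integral_const, probReal_univ, one_smul]
  have := mul_le_mul_of_nonneg_left j2 (sq_nonneg γ)
  linarith

section Run

variable {T : ℕ} {s : Ω → RunState (EuclideanSpace ℝ (Fin d))}
  {H : Ω → EuclideanSpace ℝ (Fin d) → S → EuclideanSpace ℝ (Fin d)}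
  {c p : Ω → EuclideanSpace ℝ (Fin d)}

omit [IsProbabilityMeasure P] [IsProbabilityMeasure Pr] in
theorem pssmIter_mem (A : StandingAssumptions X g P U G L D Pr ξ)
    (hsX : ∀ ω, (s ω).point ∈ X) (t : ℕ) (ω : Ω) :
    (pssmIter X (fun k => ξ k ω) M (H ω) (s ω) t).point ∈ X := by
  cases t with
  | zero => exact hsX ω
  | succ t => exact (nearestPoint_spec A.isClosed ⟨_, hsX ω⟩ _).1

omit [IsProbabilityMeasure P] [IsProbabilityMeasure Pr] in
theorem measurable_pssmIter (A : StandingAssumptions X g P U G L D Pr ξ)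
    (hs : Measurable[past ξ n] fun ω => (s ω).point) (hsX : ∀ ω, (s ω).point ∈ X)
    (hsn : ∀ ω, (s ω).oracleCalls = n) (hc : Measurable[past ξ n] c)
    (hH : ∀ ω x w, H ω x w = G x w + M • (x - c ω)) (t : ℕ) :
    Measurable[past ξ (n + t)] fun ω =>
      (pssmIter X (fun k => ξ k ω) M (H ω) (s ω) t).point := by
  induction t with
  | zero => exact hs
  | succ t ih =>
    simp only [pssmIter, pssmStep, pssmIter_oracleCalls, hsn, hH]
    -- Continuity of the projection needs `X` nonempty, and a point of `X` is only available from
    -- some `ω`.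
    rcases isEmpty_or_nonempty Ω with hΩ | ⟨⟨ω₀⟩⟩
    · exact @measurable_of_empty _ _ (past ξ _) _ _ _
    have hle : past ξ (n + t) ≤ past ξ (n + (t + 1)) := past_mono (by omega)
    have hx := ih.mono hle le_rfl
    have hc' : Measurable[past ξ (n + (t + 1))] c := hc.mono (past_mono (by omega)) le_rfl
    exact A.measurable_step ⟨_, hsX ω₀⟩ hx (A.pssmIter_mem hsX t) hc'
      (measurable_sample_past (by omega)) _ _

omit [IsProbabilityMeasure P] [IsProbabilityMeasure Pr] in
theorem pssm_mem (A : StandingAssumptions X g P U G L D Pr ξ) (hT : 0 < T)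
    (hsX : ∀ ω, (s ω).point ∈ X) (ω : Ω) :
    (pssm X (fun k => ξ k ω) (s ω) M (H ω) T).point ∈ X := by
  rw [pssm_point_eq_sum]
  exact A.convex.sum_mem (fun t _ => by positivity) (sum_pssm_weights hT)
    fun t _ => A.pssmIter_mem hsX t ω

omit [IsProbabilityMeasure P] [IsProbabilityMeasure Pr] in
theorem measurable_pssm (A : StandingAssumptions X g P U G L D Pr ξ)
    (hs : Measurable[past ξ n] fun ω => (s ω).point) (hsX : ∀ ω, (s ω).point ∈ X)
    (hsn : ∀ ω, (s ω).oracleCalls = n) (hc : Measurable[past ξ n] c)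
    (hH : ∀ ω x w, H ω x w = G x w + M • (x - c ω)) :
    Measurable[past ξ (n + (T - 1))] fun ω =>
      (pssm X (fun k => ξ k ω) (s ω) M (H ω) T).point := by
  simp only [pssm_point_eq_sum]
  refine Finset.measurable_fun_sum _ fun t ht => ?_
  have hle : n + t ≤ n + (T - 1) := by have := Finset.mem_range.1 ht; omega
  exact ((A.measurable_pssmIter hs hsX hsn hc hH t).mono
    (past_mono hle) le_rfl).const_smul (_ : ℝ)

/-- Distance of the output of the projected stochastic subgradient method to the minimizer. -/
theorem integral_norm_pssm_sub_sq_le (A : StandingAssumptions X g P U G L D Pr ξ) (hM : 0 < M)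
    (hT : 0 < T) (hs : Measurable[past ξ n] fun ω => (s ω).point) (hsX : ∀ ω, (s ω).point ∈ X)
    (hsn : ∀ ω, (s ω).oracleCalls = n) (hc : Measurable[past ξ n] c) (hcX : ∀ ω, c ω ∈ X)
    (hH : ∀ ω x w, H ω x w = G x w + M • (x - c ω)) (hp : Measurable[past ξ n] p)
    (hpc : ∀ ω, IsProx X g M (c ω) (p ω)) :
    ∫ ω, ‖(pssm X (fun k => ξ k ω) (s ω) M (H ω) T).point - p ω‖ ^ 2 ∂Pr ≤
      4 * (2 * L ^ 2 + 2 * M ^ 2 * D ^ 2) / (M ^ 2 * ((T : ℝ) + 1)) := by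
  set B := 2 * L ^ 2 + 2 * M ^ 2 * D ^ 2 with hB
  set x : ℕ → Ω → EuclideanSpace ℝ (Fin d) := fun t ω =>
    (pssmIter X (fun k => ξ k ω) M (H ω) (s ω) t).point with hxdef
  have hxX : ∀ t ω, x t ω ∈ X := fun t ω => A.pssmIter_mem hsX t ω
  have hpX : ∀ ω, p ω ∈ X := fun ω => (hpc ω).1
  have hxm : ∀ t, Measurable[past ξ (n + t)] (x t) := A.measurable_pssmIter hs hsX hsn hc hH
  have hxm' : ∀ t, Measurable (x t) := fun t =>
    (hxm t).mono (past_le A.sample_measurable _) le_rfl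
  have hpm' : Measurable p := hp.mono (past_le A.sample_measurable _) le_rfl
  set a : ℕ → ℝ := fun t => ∫ ω, ‖x t ω - p ω‖ ^ 2 ∂Pr with ha
  have ha0 : ∀ t, 0 ≤ a t := fun t => integral_nonneg fun ω => by positivity
  -- Multiplying the one-step bound by `(t + 1)²` makes it telescope: the coefficient of `a t` is
  -- `t² - 2t - 3`, and adding `2(t + 1)` gives `t² - 1 ≤ t²`. The terms `2(t + 1) a t` match the
  -- averaging weights.
  have hstep : ∀ t : ℕ, 2 * ((t : ℝ) + 1) * a t ≤
      (t : ℝ) ^ 2 * a t - ((t : ℝ) + 1) ^ 2 * a (t + 1) + 4 * B / M ^ 2 := fun t => by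
    have h := A.integral_step_le (x := x t) (x' := x (t + 1)) (γ := 2 / (M * ((t : ℝ) + 1)))
      hM (hxm t) (hxX t) hcX (hp.mono (past_mono (by omega)) le_rfl) hpc (by positivity)
      (fun ω => by
        simp only [hxdef, pssmIter, pssmStep, pssmIter_oracleCalls, hsn, hH]) (hxm' (t + 1))
    have h2 := mul_le_mul_of_nonneg_left h (sq_nonneg ((t : ℝ) + 1))
    have e : ((t : ℝ) + 1) ^ 2 * ((1 - 2 * (2 / (M * ((t : ℝ) + 1))) * M) * a t +
        (2 / (M * ((t : ℝ) + 1))) ^ 2 * B) =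
        ((t : ℝ) ^ 2 - 2 * t - 3) * a t + 4 * B / M ^ 2 := by
      field_simp; ring
    rw [e] at h2
    nlinarith [ha0 t]
  have hsum : ∀ T : ℕ, ∑ t ∈ Finset.range T, 2 * ((t : ℝ) + 1) * a t ≤
      T * (4 * B / M ^ 2) - (T : ℝ) ^ 2 * a T := fun T => by
    induction T with
    | zero => simp
    | succ T ih =>
      rw [Finset.sum_range_succ]
      push_cast
      linarith [hstep T]
  have hT' : (0 : ℝ) < T := Nat.cast_pos.2 hT
  have hint : ∀ t, Integrable (fun ω => ‖x t ω - p ω‖ ^ 2) Pr := fun t =>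
    A.integrable_norm_sub_pow (hxm' t) (hxX t) hpm' hpX 2
  calc _ ≤ ∫ ω, ∑ t ∈ Finset.range T,
        2 / ((T : ℝ) * ((T : ℝ) + 1)) * ((t : ℝ) + 1) * ‖x t ω - p ω‖ ^ 2 ∂Pr := by
        refine integral_mono (A.integrable_norm_sub_pow
          ((A.measurable_pssm hs hsX hsn hc hH).mono (past_le A.sample_measurable _) le_rfl)
          (A.pssm_mem hT hsX) hpm' hpX 2) (integrable_finsetSum _ fun t _ =>
          (hint t).const_mul _) fun ω => ?_
        dsimp only
        rw [pssm_point_eq_sum]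
        exact norm_sub_sq_sum_le (fun t _ => by positivity) (sum_pssm_weights hT) _
    _ = 1 / ((T : ℝ) * ((T : ℝ) + 1)) * ∑ t ∈ Finset.range T, 2 * ((t : ℝ) + 1) * a t := by
        rw [integral_finsetSum _ fun t _ => (hint t).const_mul _, Finset.mul_sum]
        refine Finset.sum_congr rfl fun t _ => ?_
        rw [integral_const_mul]
        ring
    _ ≤ 1 / ((T : ℝ) * ((T : ℝ) + 1)) * (T * (4 * B / M ^ 2)) := by
        gcongr
        nlinarith [hsum T, ha0 T]
    _ = _ := by field_simp

end Run

end StandingAssumptions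

end PSSM

/-! ### Cumulative weights and centers -/

/-- The cumulative weight `μ_0 + ⋯ + μ_i`. -/
noncomputable def totalWeight (μ : ℝ) (i : ℕ) : ℝ := ∑ j ∈ Finset.range (i + 1), weight μ j

theorem weight_pos {μ : ℝ} (hμ : 0 < μ) (i : ℕ) : 0 < weight μ i := by
  unfold weight; positivity

theorem weight_zero (μ : ℝ) : weight μ 0 = μ := by simp [weight]

theorem totalWeight_zero (μ : ℝ) : totalWeight μ 0 = μ := by simp [totalWeight, weight_zero]

theorem totalWeight_succ (μ : ℝ) (i : ℕ) :
    totalWeight μ (i + 1) = totalWeight μ i + weight μ (i + 1) := Finset.sum_range_succ _ _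

theorem totalWeight_eq (μ : ℝ) (i : ℕ) : totalWeight μ i = μ * (2 ^ (i + 1) - 1) := by
  induction i with
  | zero => rw [totalWeight_zero]; ring
  | succ i ih => rw [totalWeight_succ, ih, weight]; ring

theorem totalWeight_pos {μ : ℝ} (hμ : 0 < μ) (i : ℕ) : 0 < totalWeight μ i :=
  Finset.sum_pos (fun _ _ => weight_pos hμ _) ⟨0, by simp⟩

theorem totalWeight_mono {μ : ℝ} (hμ : 0 < μ) {i j : ℕ} (h : i ≤ j) :
    totalWeight μ i ≤ totalWeight μ j :=
  Finset.sum_le_sum_of_subset_of_nonneg (Finset.range_mono (by omega))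
    fun _ _ _ => (weight_pos hμ _).le

theorem sum_range_succ_eq_add_sum_Icc {V : Type*} [AddCommMonoid V] (f : ℕ → V) (k : ℕ) :
    ∑ j ∈ Finset.range (k + 1), f j = f 0 + ∑ i ∈ Finset.Icc 1 k, f i := by
  induction k with
  | zero => simp
  | succ k ih => rw [Finset.sum_range_succ, ih, Finset.sum_Icc_succ_top (by omega), add_assoc]

theorem totalWeight_eq_add_sum (μ : ℝ) (k : ℕ) :
    totalWeight μ k = μ + ∑ i ∈ Finset.Icc 1 k, weight μ i := by
  rw [totalWeight, sum_range_succ_eq_add_sum_Icc, weight_zero]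

theorem sum_Icc_weight (μ : ℝ) (k : ℕ) :
    ∑ i ∈ Finset.Icc 1 k, weight μ i = μ * (2 ^ (k + 1) - 2) := by
  linear_combination totalWeight_eq μ k - totalWeight_eq_add_sum μ k

section Center

variable {V : Type*} [NormedAddCommGroup V] {μ : ℝ}

/-- The center of the quadratic accumulated after `i` rounds. -/
noncomputable def center [NormedSpace ℝ V] (μ : ℝ) (xh : ℕ → V) (i : ℕ) : V :=
  (Finset.range (i + 1)).centerMass (weight μ) xh

theorem totalWeight_smul_center [NormedSpace ℝ V] (hμ : 0 < μ) (xh : ℕ → V) (i : ℕ) :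
    totalWeight μ i • center μ xh i = ∑ j ∈ Finset.range (i + 1), weight μ j • xh j :=
  smul_inv_smul₀ (totalWeight_pos hμ i).ne' _

theorem totalWeight_smul_center_succ [NormedSpace ℝ V] (hμ : 0 < μ) (xh : ℕ → V) (i : ℕ) :
    totalWeight μ (i + 1) • center μ xh (i + 1) =
      totalWeight μ i • center μ xh i + weight μ (i + 1) • xh (i + 1) := by
  rw [totalWeight_smul_center hμ, totalWeight_smul_center hμ, Finset.sum_range_succ]

variable [InnerProductSpace ℝ V] {X : Set V} {g : V → ℝ} {xh xs : ℕ → V}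

/-- Passing from `xs k` to `xs (k + 1)` shifts each old distance by at most `‖xh (k + 1) - xs k‖`,
which also bounds the new distance. The weights charged to this error sum to `2 * totalWeight μ k`
because they double. -/
theorem sum_weight_mul_norm_sub_le (hg : ConvexOn ℝ X g) (hμ : 0 < μ)
    (hxs : ∀ i, IsProx X g (totalWeight μ i) (center μ xh i) (xs i)) (k : ℕ) :
    ∑ i ∈ Finset.Icc 1 k, weight μ i * ‖xh i - xs k‖ ≤
      ∑ j ∈ Finset.range k, 2 * totalWeight μ j * ‖xh (j + 1) - xs j‖ := by
  induction k with
  | zero => simp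
  | succ k ih =>
    obtain ⟨h1, h2⟩ := (hxs k).add_quadratic (p' := xs (k + 1)) hg (totalWeight_pos hμ k).le
      (weight_pos hμ (k + 1)) (totalWeight_succ μ k ▸ hxs (k + 1))
      (totalWeight_succ μ k ▸ totalWeight_smul_center_succ hμ xh k)
    have h3 : ∑ i ∈ Finset.Icc 1 k, weight μ i * ‖xh i - xs (k + 1)‖ ≤
        ∑ i ∈ Finset.Icc 1 k, (weight μ i * ‖xh i - xs k‖ +
          weight μ i * ‖xh (k + 1) - xs k‖) := by
      refine Finset.sum_le_sum fun i _ => ?_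
      rw [← mul_add]
      refine mul_le_mul_of_nonneg_left ?_ (weight_pos hμ i).le
      have := norm_sub_le_norm_sub_add_norm_sub (xh i) (xs k) (xs (k + 1))
      rw [norm_sub_rev (xs k)] at this
      linarith
    rw [Finset.sum_add_distrib, ← Finset.sum_mul] at h3
    rw [Finset.sum_Icc_succ_top (by omega), Finset.sum_range_succ]
    have h4 := mul_le_mul_of_nonneg_left h2 (weight_pos hμ (k + 1)).le
    have h5 : 2 * totalWeight μ k = ∑ i ∈ Finset.Icc 1 k, weight μ i + weight μ (k + 1) := by
      rw [totalWeight_eq, sum_Icc_weight, weight]; ring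
    rw [h5]
    linarith

/-- The output is treated as one further center update, with weight `m` instead of `weight μ (I +
1)`. Its cost `2m` is still at most `2 * totalWeight μ I`. -/
theorem norm_smul_sub_prox_le (hg : ConvexOn ℝ X g) (hμ : 0 < μ)
    (hxs : ∀ i, IsProx X g (totalWeight μ i) (center μ xh i) (xs i)) {I : ℕ} (hI : 0 < I)
    {m R D : ℝ} {z y : V} (hm : m = ∑ i ∈ Finset.Icc 1 I, weight μ i)
    (hR : R = totalWeight μ I + m)
    (hz : R • z = totalWeight μ I • center μ xh I + m • xh (I + 1)) (hy : IsProx X g R z y)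
    (hD : ‖xh 0 - y‖ ≤ D) :
    ‖R • (z - y)‖ ≤ μ * D +
      ∑ j ∈ Finset.range (I + 1), 2 * totalWeight μ j * ‖xh (j + 1) - xs j‖ := by
  have hm0 : 0 < m := hm ▸ Finset.sum_pos (fun i _ => weight_pos hμ i) ⟨1, by simp; omega⟩
  set δ := ‖xh (I + 1) - xs I‖ with hδ
  obtain ⟨h1, h2⟩ := (hxs I).add_quadratic (p' := y) (u := xh (I + 1)) hg
    (totalWeight_pos hμ I).le hm0 (hR ▸ hy) (hR ▸ hz)
  have e1 : R • (z - y) = μ • (xh 0 - y) + ∑ i ∈ Finset.Icc 1 I, weight μ i • (xh i - y) +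
      m • (xh (I + 1) - y) := by
    simp only [smul_sub, Finset.sum_sub_distrib, ← Finset.sum_smul, ← hm]
    rw [hz, totalWeight_smul_center hμ, sum_range_succ_eq_add_sum_Icc, weight_zero, hR,
      totalWeight_eq_add_sum, ← hm]
    module
  have h3 : ‖∑ i ∈ Finset.Icc 1 I, weight μ i • (xh i - y)‖ ≤
      ∑ i ∈ Finset.Icc 1 I, (weight μ i * ‖xh i - xs I‖ + weight μ i * δ) := by
    refine norm_sum_le_of_le _ fun i _ => ?_
    rw [norm_smul, Real.norm_of_nonneg (weight_pos hμ i).le, ← mul_add]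
    refine mul_le_mul_of_nonneg_left ?_ (weight_pos hμ i).le
    have := norm_sub_le_norm_sub_add_norm_sub (xh i) (xs I) y
    rw [norm_sub_rev (xs I)] at this
    linarith
  rw [Finset.sum_add_distrib, ← Finset.sum_mul, ← hm] at h3
  have h4 := sum_weight_mul_norm_sub_le hg hμ hxs I
  have h5 : m ≤ totalWeight μ I := by rw [hm, totalWeight_eq_add_sum]; linarith
  rw [e1, Finset.sum_range_succ]
  refine (norm_add₃_le).trans ?_
  rw [norm_smul, norm_smul, Real.norm_of_nonneg hμ.le, Real.norm_of_nonneg hm0.le]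
  have h6 := mul_le_mul_of_nonneg_left hD hμ.le
  have h7 := mul_le_mul_of_nonneg_left h2 hm0.le
  have h8 := mul_le_mul_of_nonneg_right h5 (norm_nonneg (xh (I + 1) - xs I))
  linarith

end Center

/-! ### Gradual regularization -/

section Gradual

variable {E S : Type*} [NormedAddCommGroup E] [NormedSpace ℝ E] (X : Set E) (ξ : ℕ → S)
  (s : RunState E) (μ : ℝ) (T : ℕ)

theorem gradualState_oracleCalls (G : E → S → E) (i : ℕ) :
    (gradualState X ξ s μ T G i).1.oracleCalls = s.oracleCalls + i * (T - 1) := by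
  induction i with
  | zero => simp [gradualState]
  | succ i ih =>
    simp only [gradualState, pssm, pssmIter_oracleCalls, ih]; ring

theorem gradualState_projCalls (G : E → S → E) (i : ℕ) :
    (gradualState X ξ s μ T G i).1.projCalls = s.projCalls + i * (T - 1) := by
  induction i with
  | zero => simp [gradualState]
  | succ i ih =>
    simp only [gradualState, pssm, pssmIter_projCalls, ih]; ring

variable {μ}

/-- The accumulated linear terms `weight μ j • (x - xh j)` merge into a single one at their weighted
mean, so every round is the same proximal subproblem with new weight and center. -/
theorem gradualState_oracle (hμ : 0 < μ) (G : E → S → E) (i : ℕ) (x : E) (w : S) :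
    (gradualState X ξ s μ T (fun x w => G x w + μ • (x - s.point)) i).2 x w =
      G x w + totalWeight μ i • (x - center μ (fun j =>
        (gradualState X ξ s μ T (fun x w => G x w + μ • (x - s.point)) j).1.point) i) := by
  set xh : ℕ → E := fun j =>
    (gradualState X ξ s μ T (fun x w => G x w + μ • (x - s.point)) j).1.point with hxh
  induction i with
  | zero =>
    have h : totalWeight μ 0 • center μ xh 0 = μ • s.point := by
      rw [totalWeight_smul_center hμ]; simp [weight_zero, hxh, gradualState]
    rw [smul_sub, h, totalWeight_zero, ← smul_sub]
    rfl
  | succ i ih =>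
    rw [smul_sub, totalWeight_smul_center_succ hμ, totalWeight_succ]
    change (gradualState X ξ s μ T (fun x w => G x w + μ • (x - s.point)) i).2 x w +
      weight μ (i + 1) • (x - xh (i + 1)) = _
    rw [ih]
    module

theorem oracleCalls_add_projCalls_convexGradualReg (xc : E) (μ lam : ℝ) (I : ℕ)
    (G : E → S → E) :
    (convexGradualReg X ξ xc μ lam T I G).oracleCalls +
      (convexGradualReg X ξ xc μ lam T I G).projCalls = 2 * ((I + 1) * (T - 1)) := by
  simp only [convexGradualReg, gradualReg, gradualState_oracleCalls, gradualState_projCalls]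
  ring

end Gradual

/-- Integrate `f ≤ a / 2 + f² / (2a)`. -/
theorem integral_le_of_integral_sq_le {Ω : Type*} [MeasurableSpace Ω] {Pr : Measure Ω}
    [IsProbabilityMeasure Pr] {f : Ω → ℝ} {a : ℝ} (ha : 0 < a) (hf : Integrable f Pr)
    (hf2 : Integrable (fun ω => f ω ^ 2) Pr) (h : ∫ ω, f ω ^ 2 ∂Pr ≤ a ^ 2) :
    ∫ ω, f ω ∂Pr ≤ a := by
  have hi : Integrable (fun ω => a / 2 + f ω ^ 2 / (2 * a)) Pr :=
    (integrable_const _).add (hf2.div_const _)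
  calc ∫ ω, f ω ∂Pr ≤ ∫ ω, (a / 2 + f ω ^ 2 / (2 * a)) ∂Pr := by
        refine integral_mono hf hi fun ω => ?_
        have : a / 2 + f ω ^ 2 / (2 * a) - f ω = (f ω - a) ^ 2 / (2 * a) := by field_simp; ring
        have h2 : 0 ≤ (f ω - a) ^ 2 / (2 * a) := by positivity
        linarith
    _ = a / 2 + (∫ ω, f ω ^ 2 ∂Pr) / (2 * a) := by
        rw [integral_add (integrable_const _) (hf2.div_const _), integral_div (2 * a)]; simp
    _ ≤ a / 2 + a ^ 2 / (2 * a) := by gcongr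
    _ = a := by field_simp; ring

/-! ### Expected stationarity of the output. -/

section Convergence

variable {d : ℕ} {S Ω : Type*} [MeasurableSpace S] [MeasurableSpace Ω]
  {X U : Set (EuclideanSpace ℝ (Fin d))} {g : EuclideanSpace ℝ (Fin d) → ℝ} {P : Measure S}
  {G : EuclideanSpace ℝ (Fin d) → S → EuclideanSpace ℝ (Fin d)} {L D ρ μ lam : ℝ}
  {Pr : Measure Ω} {ξ : ℕ → Ω → S} {xc : EuclideanSpace ℝ (Fin d)} {T I : ℕ}

/-- The centers `x̂_i` of gradual regularization on the oracle `G + μ (· - xc)`. -/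
noncomputable def xhat (X : Set (EuclideanSpace ℝ (Fin d))) (ξ : ℕ → Ω → S)
    (xc : EuclideanSpace ℝ (Fin d)) (μ : ℝ) (T : ℕ)
    (G : EuclideanSpace ℝ (Fin d) → S → EuclideanSpace ℝ (Fin d)) (ω : Ω) (i : ℕ) :
    EuclideanSpace ℝ (Fin d) :=
  (gradualState X (fun k => ξ k ω) ⟨xc, 0, 0⟩ μ T (fun x w => G x w + μ • (x - xc)) i).1.point

namespace StandingAssumptions

theorem xhat_mem (A : StandingAssumptions X g P U G L D Pr ξ) (hxc : xc ∈ X) (hT : 0 < T)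
    (i : ℕ) (ω : Ω) : xhat X ξ xc μ T G ω i ∈ X := by
  induction i generalizing ω with
  | zero => exact hxc
  | succ i ih =>
    exact A.pssm_mem (M := totalWeight μ i)
      (s := fun ω => (gradualState X (fun k => ξ k ω) ⟨xc, 0, 0⟩ μ T
        (fun x w => G x w + μ • (x - xc)) i).1)
      (H := fun ω => (gradualState X (fun k => ξ k ω) ⟨xc, 0, 0⟩ μ T
        (fun x w => G x w + μ • (x - xc)) i).2) hT ih ω

theorem center_mem (A : StandingAssumptions X g P U G L D Pr ξ) (hxc : xc ∈ X) (hT : 0 < T)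
    (hμ : 0 < μ) (i : ℕ) (ω : Ω) : center μ (xhat X ξ xc μ T G ω) i ∈ X :=
  A.convex.centerMass_mem (fun _ _ => (weight_pos hμ _).le) (totalWeight_pos hμ i)
    fun j _ => A.xhat_mem hxc hT j ω

omit [MeasurableSpace S] [MeasurableSpace Ω] in
theorem measurable_center {m : MeasurableSpace Ω} {i : ℕ}
    (h : ∀ j ≤ i, Measurable fun ω => xhat X ξ xc μ T G ω j) :
    Measurable fun ω => center μ (xhat X ξ xc μ T G ω) i := by
  unfold center Finset.centerMass
  refine (Finset.measurable_fun_sum _ fun j hj => ?_).const_smul (_ : ℝ)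
  exact (h j (by have := Finset.mem_range.1 hj; omega)).const_smul (_ : ℝ)

theorem measurable_xhat (A : StandingAssumptions X g P U G L D Pr ξ) (hxc : xc ∈ X)
    (hT : 0 < T) (hμ : 0 < μ) (i : ℕ) :
    Measurable[past ξ (i * (T - 1))] fun ω => xhat X ξ xc μ T G ω i := by
  induction i using Nat.strong_induction_on with
  | _ i ih =>
    cases i with
    | zero => exact measurable_const
    | succ i =>
      rw [Nat.succ_mul]
      refine A.measurable_pssm (c := fun ω => center μ (xhat X ξ xc μ T G ω) i)
        (ih i i.lt_succ_self) (A.xhat_mem hxc hT i) (fun ω => ?_) ?_ fun ω x w => ?_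
      · simp [gradualState_oracleCalls]
      · exact measurable_center fun j hj => (ih j (by omega)).mono
          (past_mono (Nat.mul_le_mul_right _ hj)) le_rfl
      · exact gradualState_oracle X _ ⟨xc, 0, 0⟩ T hμ G i x w

variable [IsProbabilityMeasure P] [IsProbabilityMeasure Pr]

theorem integral_norm_xhat_sub_prox_le (A : StandingAssumptions X g P U G L D Pr ξ)
    (hD : 0 < D) (hxc : xc ∈ X) (hT : 0 < T) (hμ : 0 < μ) (i : ℕ)
    {Q : EuclideanSpace ℝ (Fin d) → EuclideanSpace ℝ (Fin d)}
    (hQ : ∀ c, IsProx X g (totalWeight μ i) c (Q c)) :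
    Integrable (fun ω => ‖xhat X ξ xc μ T G ω (i + 1) -
      Q (center μ (xhat X ξ xc μ T G ω) i)‖) Pr ∧
    ∫ ω, ‖xhat X ξ xc μ T G ω (i + 1) - Q (center μ (xhat X ξ xc μ T G ω) i)‖ ∂Pr ≤
      2 * √(2 * L ^ 2 + 2 * totalWeight μ i ^ 2 * D ^ 2) /
        (totalWeight μ i * √((T : ℝ) + 1)) := by
  have hM := totalWeight_pos hμ i
  have hc : Measurable[past ξ (i * (T - 1))] fun ω => center μ (xhat X ξ xc μ T G ω) i :=
    measurable_center fun j hj => (A.measurable_xhat hxc hT hμ j).mono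
      (past_mono (Nat.mul_le_mul_right _ hj)) le_rfl
  have hp : Measurable[past ξ (i * (T - 1))] fun ω => Q (center μ (xhat X ξ xc μ T G ω) i) :=
    (continuous_of_isProx A.convexOn_set hM hQ).measurable.comp hc
  have hint : ∀ k : ℕ, Integrable (fun ω => ‖xhat X ξ xc μ T G ω (i + 1) -
      Q (center μ (xhat X ξ xc μ T G ω) i)‖ ^ k) Pr := A.integrable_norm_sub_pow
    ((A.measurable_xhat hxc hT hμ (i + 1)).mono (past_le A.sample_measurable _) le_rfl)
    (A.xhat_mem hxc hT (i + 1)) (hp.mono (past_le A.sample_measurable _) le_rfl)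
    fun ω => (hQ _).1
  have h1 : Integrable (fun ω => ‖xhat X ξ xc μ T G ω (i + 1) -
      Q (center μ (xhat X ξ xc μ T G ω) i)‖) Pr := by simpa using hint 1
  refine ⟨h1, integral_le_of_integral_sq_le (by positivity) h1 (hint 2) ?_⟩
  rw [div_pow, mul_pow, mul_pow, Real.sq_sqrt (by positivity), Real.sq_sqrt (by positivity)]
  refine (A.integral_norm_pssm_sub_sq_le hM hT (A.measurable_xhat hxc hT hμ i)
    (A.xhat_mem hxc hT i) (fun ω => ?_) hc (A.center_mem hxc hT hμ i)
    (fun ω x w => gradualState_oracle X _ ⟨xc, 0, 0⟩ T hμ G i x w) hp fun ω => hQ _).trans_eq ?_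
  · simp [gradualState_oracleCalls]
  · norm_num

omit [MeasurableSpace S] [MeasurableSpace Ω] [IsProbabilityMeasure P] [IsProbabilityMeasure Pr] in
-- By `hlam` the normalizer inside `gradualReg` is `lam`, which cancels the numerator of `lam / (μ +
-- lam)`.
theorem smul_point_convexGradualReg (hμ : 0 < μ) (hI : 0 < I)
    (hlam : lam / 2 = ∑ i ∈ Finset.Icc 1 I, weight μ i) (ω : Ω) :
    (convexGradualReg X (fun k => ξ k ω) xc μ lam T I G).point =
      (totalWeight μ I + lam / 2)⁻¹ • (totalWeight μ I • center μ (xhat X ξ xc μ T G ω) I +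
        (lam / 2) • xhat X ξ xc μ T G ω (I + 1)) := by
  have hl : 0 < lam / 2 :=
    hlam ▸ Finset.sum_pos (fun i _ => weight_pos hμ i) ⟨1, by simp; omega⟩
  have hl0 : lam ≠ 0 := by linarith
  rw [totalWeight_smul_center hμ, sum_range_succ_eq_add_sum_Icc, weight_zero,
    totalWeight_eq_add_sum, ← hlam, add_assoc μ, add_halves]
  have h : (convexGradualReg X (fun k => ξ k ω) xc μ lam T I G).point =
      (μ / (μ + lam)) • xc + (lam / (μ + lam)) • ((1 / (lam / 2 +
        ∑ i ∈ Finset.Icc 1 I, weight μ i)) • ((lam / 2) • xhat X ξ xc μ T G ω (I + 1) +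
          ∑ i ∈ Finset.Icc 1 I, weight μ i • xhat X ξ xc μ T G ω i)) := rfl
  rw [h, ← hlam, add_halves, smul_smul, div_mul_div_comm, mul_one, div_mul_cancel_right₀ hl0,
    div_eq_inv_mul, mul_smul]
  have h0 : xhat X ξ xc μ T G ω 0 = xc := rfl
  rw [h0]
  module

/-- The convergence guarantee in terms of the parameters of the algorithm. -/
theorem integral_stationarity_le (A : StandingAssumptions X g P U G L D Pr ξ)
    (hD : 0 < D) (hxc : xc ∈ X) (hT : 0 < T) (hμ : 0 < μ) (hI : 0 < I) (hρ : 0 < ρ)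
    (hlam : lam / 2 = ∑ i ∈ Finset.Icc 1 I, weight μ i) (hρl : 2 * ρ = μ + lam) :
    (∀ ω, (convexGradualReg X (fun k => ξ k ω) xc μ lam T I G).point ∈ X) ∧
    Integrable (fun ω => stationarity ρ X g
      (convexGradualReg X (fun k => ξ k ω) xc μ lam T I G).point) Pr ∧
    ∫ ω, stationarity ρ X g
      (convexGradualReg X (fun k => ξ k ω) xc μ lam T I G).point ∂Pr ≤
      4 * ((I : ℝ) + 1) * √(2 * L ^ 2 + 2 * totalWeight μ I ^ 2 * D ^ 2) /
        √((T : ℝ) + 1) + μ * D := by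
  set z : Ω → EuclideanSpace ℝ (Fin d) := fun ω =>
    (convexGradualReg X (fun k => ξ k ω) xc μ lam T I G).point with hz
  have hzω : ∀ ω, (convexGradualReg X (fun k => ξ k ω) xc μ lam T I G).point = z ω :=
    fun _ => rfl
  simp only [hzω]
  have hl : 0 < lam / 2 :=
    hlam ▸ Finset.sum_pos (fun i _ => weight_pos hμ i) ⟨1, by simp; omega⟩
  have hMI := totalWeight_pos hμ I
  have hR : 2 * ρ = totalWeight μ I + lam / 2 := by
    rw [totalWeight_eq_add_sum, ← hlam]; linarith
  have hzeq : ∀ ω, z ω = (2 * ρ)⁻¹ • (totalWeight μ I • center μ (xhat X ξ xc μ T G ω) I +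
      (lam / 2) • xhat X ξ xc μ T G ω (I + 1)) := fun ω =>
    hR ▸ smul_point_convexGradualReg hμ hI hlam ω
  have hzX : ∀ ω, z ω ∈ X := fun ω => by
    rw [hzeq ω, smul_add, smul_smul, smul_smul]
    refine A.convex (A.center_mem hxc hT hμ I ω) (A.xhat_mem hxc hT (I + 1) ω)
      (by positivity) (by positivity) ?_
    rw [← mul_add, ← hR, inv_mul_cancel₀ (by positivity)]
  have hxm : ∀ j, Measurable fun ω => xhat X ξ xc μ T G ω j := fun j =>
    (A.measurable_xhat hxc hT hμ j).mono (past_le A.sample_measurable _) le_rfl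
  have hzm : Measurable z := by
    rw [funext hzeq]
    exact (((measurable_center fun j _ => hxm j).const_smul (_ : ℝ)).add
      ((hxm (I + 1)).const_smul (_ : ℝ))).const_smul (_ : ℝ)
  choose Q hQ using fun i c => A.exists_prox ⟨xc, hxc⟩ (totalWeight μ i) c
  choose Y hY using fun c => A.exists_prox ⟨xc, hxc⟩ (2 * ρ) c
  have hst : ∀ ω, stationarity ρ X g (z ω) = 2 * ρ * ‖z ω - Y (z ω)‖ := fun ω => by
    rw [stationarity_eq A.convexOn_set hρ hY, norm_smul, Real.norm_of_nonneg (by positivity)]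
  have hYm : Measurable fun ω => Y (z ω) :=
    (continuous_of_isProx A.convexOn_set (by positivity) hY).measurable.comp hzm
  have hint : Integrable (fun ω => stationarity ρ X g (z ω)) Pr := by
    simp only [hst]
    have := A.integrable_norm_sub_pow hzm hzX hYm (fun ω => (hY _).1) 1
    simp only [pow_one] at this
    exact this.const_mul _
  refine ⟨hzX, hint, ?_⟩
  have hδ := fun i => A.integral_norm_xhat_sub_prox_le hD hxc hT hμ i (hQ i)
  have hpt : ∀ ω, stationarity ρ X g (z ω) ≤ μ * D + ∑ j ∈ Finset.range (I + 1),
      2 * totalWeight μ j * ‖xhat X ξ xc μ T G ω (j + 1) -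
        Q j (center μ (xhat X ξ xc μ T G ω) j)‖ := fun ω => by
    rw [stationarity_eq A.convexOn_set hρ hY]
    refine norm_smul_sub_prox_le A.convexOn_set hμ
      (xs := fun j => Q j (center μ (xhat X ξ xc μ T G ω) j)) (fun i => hQ i _) hI hlam hR ?_
      (hY (z ω)) (A.diam_le _ (A.xhat_mem hxc hT 0 ω) _ (hY (z ω)).1)
    rw [hzeq ω, smul_inv_smul₀ (by positivity)]
  have hsum : ∀ j ∈ Finset.range (I + 1), Integrable (fun ω => 2 * totalWeight μ j *
      ‖xhat X ξ xc μ T G ω (j + 1) - Q j (center μ (xhat X ξ xc μ T G ω) j)‖) Pr :=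
    fun j _ => (hδ j).1.const_mul _
  refine (integral_mono hint ((integrable_const (μ * D)).add
    (integrable_finsetSum _ hsum)) hpt).trans ?_
  rw [integral_add' (integrable_const _) (integrable_finsetSum _ hsum),
    integral_finsetSum _ hsum, add_comm]
  simp only [integral_const, probReal_univ, one_smul]
  gcongr
  have hterm : ∀ j ∈ Finset.range (I + 1), ∫ ω, 2 * totalWeight μ j *
      ‖xhat X ξ xc μ T G ω (j + 1) - Q j (center μ (xhat X ξ xc μ T G ω) j)‖ ∂Pr ≤
      4 * √(2 * L ^ 2 + 2 * totalWeight μ I ^ 2 * D ^ 2) / √((T : ℝ) + 1) := fun j hj => by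
    have hMj := totalWeight_pos hμ j
    have hle := totalWeight_mono hμ (Nat.lt_succ_iff.1 (Finset.mem_range.1 hj))
    rw [integral_const_mul]
    calc _ ≤ 2 * totalWeight μ j * (2 * √(2 * L ^ 2 + 2 * totalWeight μ j ^ 2 * D ^ 2) /
          (totalWeight μ j * √((T : ℝ) + 1))) := by gcongr; exact (hδ j).2
      -- The weight of the round cancels here, so only the square root still depends on `j`.
      _ = 4 * √(2 * L ^ 2 + 2 * totalWeight μ j ^ 2 * D ^ 2) / √((T : ℝ) + 1) := by
          field_simp; ring
      _ ≤ _ := by gcongr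
  refine (Finset.sum_le_sum hterm).trans_eq ?_
  simp only [Finset.sum_const, Finset.card_range, nsmul_eq_mul]
  push_cast
  ring

end StandingAssumptions

end Convergence

/-! ### Choice of the parameters. -/

theorem two_pow_eq_of_logb {I : ℕ} {q : ℝ} (hq : 0 < q) (hI : (I : ℝ) = Real.logb 2 q) :
    (2 : ℝ) ^ I = q := by
  rw [← Real.rpow_natCast, hI, Real.rpow_logb two_pos (by norm_num) hq]

section Final

variable {d : ℕ} {S Ω : Type*} [MeasurableSpace S] [MeasurableSpace Ω]
  {X U : Set (EuclideanSpace ℝ (Fin d))} {g : EuclideanSpace ℝ (Fin d) → ℝ} {P : Measure S}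
  {G : EuclideanSpace ℝ (Fin d) → S → EuclideanSpace ℝ (Fin d)} {L D ρ ε : ℝ}
  {Pr : Measure Ω} {ξ : ℕ → Ω → S} {xc : EuclideanSpace ℝ (Fin d)} {T I : ℕ}

theorem StandingAssumptions.moreau_finite_differentiable
    (A : StandingAssumptions X g P U G L D Pr ξ) (hne : X.Nonempty) (hρ : 0 < ρ) :
    (∀ x, moreauEnvelope (objective X g) (1 / (2 * ρ)) x ≠ ⊤ ∧
      moreauEnvelope (objective X g) (1 / (2 * ρ)) x ≠ ⊥) ∧
    Differentiable ℝ (moreauReal (objective X g) (1 / (2 * ρ))) := by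
  choose Y hY using fun c => A.exists_prox hne (2 * ρ) c
  refine ⟨fun x => ?_, fun x => (hasGradientAt_moreauReal A.convexOn_set hρ hY x).differentiableAt⟩
  rw [moreauEnvelope_eq_of_isProx (hY x)]
  exact ⟨EReal.coe_ne_top _, EReal.coe_ne_bot _⟩

theorem round_count_pos (hε : 0 < ε) (hεD : ε ≤ 2 * ρ * D)
    (hI : (2 : ℝ) ^ I = 3 / 4 + ρ * D / ε) : 0 < I := by
  have h : 1 / 2 ≤ ρ * D / ε := by rw [le_div_iff₀ hε]; linarith
  rcases I.eq_zero_or_pos with rfl | h0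
  · norm_num at hI; linarith
  · exact h0

/-- The convergence guarantee for `μ = ε / (2D)` and `λ = 2ρ - ε / (2D)`. -/
theorem StandingAssumptions.integral_stationarity_le_of_two_pow [IsProbabilityMeasure P]
    [IsProbabilityMeasure Pr] (A : StandingAssumptions X g P U G L D Pr ξ)
    (hD : 0 < D) (hρ : 0 < ρ) (hxc : xc ∈ X) (hε : 0 < ε) (hεD : ε ≤ 2 * ρ * D)
    (hI : (2 : ℝ) ^ I = 3 / 4 + ρ * D / ε) (hT : 0 < T)
    {z : Ω → RunState (EuclideanSpace ℝ (Fin d))}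
    (hz : ∀ ω, z ω = convexGradualReg X (fun n => ξ n ω) xc
      (ε / (2 * D)) (2 * ρ - ε / (2 * D)) T I G) :
    (∀ ω, (z ω).point ∈ X) ∧ Integrable (fun ω => stationarity ρ X g (z ω).point) Pr ∧
    ∫ ω, stationarity ρ X g (z ω).point ∂Pr ≤
      28 * √2 * I * √(2 * L ^ 2 + 3 * ρ ^ 2 * D ^ 2) / √((T : ℝ) + 1) + ε / 2 := by
  have hI0 := round_count_pos hε hεD hI
  simp only [hz]
  obtain ⟨h1, h2, h3⟩ := A.integral_stationarity_le (μ := ε / (2 * D))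
    (lam := 2 * ρ - ε / (2 * D)) hD hxc hT (by positivity) hI0 hρ
    -- The offset `3/4` in `2 ^ I` is what makes `μ(2^(I+1) - 2)` equal to `ρ - ε/(4D) = λ/2`.
    (by rw [sum_Icc_weight, pow_succ, hI]; field_simp; ring) (by ring)
  refine ⟨h1, h2, h3.trans ?_⟩
  have hM : totalWeight (ε / (2 * D)) I = ρ + ε / (4 * D) := by
    rw [totalWeight_eq, pow_succ, hI]; field_simp; ring
  have hM' : ρ + ε / (4 * D) ≤ 3 / 2 * ρ := by
    have : ε / (4 * D) ≤ 1 / 2 * ρ := by rw [div_le_iff₀ (by positivity)]; linarith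
    linarith
  have hμD : ε / (2 * D) * D = ε / 2 := by field_simp
  rw [hμD, hM]
  have hI1 : (1 : ℝ) ≤ I := Nat.one_le_cast.2 hI0
  have hsqrt : √(2 * L ^ 2 + 2 * (ρ + ε / (4 * D)) ^ 2 * D ^ 2) ≤
      2 * √(2 * L ^ 2 + 3 * ρ ^ 2 * D ^ 2) := by
    have h4 : (2 : ℝ) = √4 := by
      rw [show (4 : ℝ) = 2 ^ 2 by norm_num, Real.sqrt_sq two_pos.le]
    rw [h4, ← Real.sqrt_mul (by norm_num), ← h4]
    refine Real.sqrt_le_sqrt ?_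
    calc _ ≤ 2 * L ^ 2 + 2 * (3 / 2 * ρ) ^ 2 * D ^ 2 := by gcongr
      _ ≤ _ := by nlinarith [sq_nonneg L, sq_nonneg (ρ * D)]
  have h2 : (1 : ℝ) ≤ √2 := Real.one_le_sqrt.2 (by norm_num)
  gcongr ?_ / _ + _
  calc _ ≤ 4 * ((I : ℝ) + I) * (2 * √(2 * L ^ 2 + 3 * ρ ^ 2 * D ^ 2)) := by gcongr
    _ = 16 * 1 * I * √(2 * L ^ 2 + 3 * ρ ^ 2 * D ^ 2) := by ring
    _ ≤ _ := by gcongr; norm_num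

/-- An admissible accuracy below the target, with the number of rounds it requires. -/
theorem exists_admissible_accuracy (hD : 0 < D) (hρ : 0 < ρ) (hε : 0 < ε)
    (hεD : ε ≤ 4 / 5 * (ρ * D)) : ∃ (ε' : ℝ) (I : ℕ), 0 < ε' ∧ ε' ≤ ε ∧
      (I : ℝ) = Real.logb 2 (3 / 4 + ρ * D / ε') ∧
      ((∃ n : ℕ, (n : ℝ) = Real.logb 2 (3 / 4 + ρ * D / ε)) → ε' = ε) ∧
      (I : ℝ) ≤ 24 * Real.log (ρ * D / ε) := by
  have hρD : 0 < ρ * D := by positivity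
  obtain ⟨q, hq⟩ : ∃ q, q = ρ * D / ε := ⟨_, rfl⟩
  have hq54 : 5 / 4 ≤ q := by rw [hq, le_div_iff₀ hε]; linarith
  have hq34 : 0 < 3 / 4 + q := by linarith
  have hεq : ε * q = ρ * D := by rw [hq]; field_simp
  rw [← hq]
  obtain ⟨I, hI⟩ : ∃ I, I = ⌈Real.logb 2 (3 / 4 + q)⌉₊ := ⟨_, rfl⟩
  have hlogb : 0 ≤ Real.logb 2 (3 / 4 + q) := Real.logb_nonneg one_lt_two (by linarith)
  have hle : Real.logb 2 (3 / 4 + q) ≤ I := hI ▸ Nat.le_ceil _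
  have hlt : (I : ℝ) < Real.logb 2 (3 / 4 + q) + 1 := hI ▸ Nat.ceil_lt_add_one hlogb
  have hpow : 3 / 4 + q ≤ 2 ^ I := by
    rw [← Real.rpow_natCast]
    exact (Real.logb_le_iff_le_rpow one_lt_two hq34).1 hle
  have hpos : (0 : ℝ) < 2 ^ I - 3 / 4 := by linarith
  have heq : 3 / 4 + ρ * D / (ρ * D / (2 ^ I - 3 / 4)) = 2 ^ I := by field_simp; ring
  -- Solves `3/4 + ρD/ε' = 2^I` with the logarithm rounded up, which can only decrease the accuracy
  -- parameter.
  refine ⟨ρ * D / (2 ^ I - 3 / 4), I, by positivity, ?_, ?_, ?_, ?_⟩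
  · rw [div_le_iff₀ hpos, ← hεq]
    gcongr
    linarith
  · rw [heq, ← Real.rpow_natCast, Real.logb_rpow two_pos (by norm_num)]
  · rintro ⟨n, hn⟩
    have hIn : I = n := by rw [hI, ← hn, Nat.ceil_natCast]
    rw [hIn, two_pow_eq_of_logb hq34 hn, add_sub_cancel_left, ← hεq]
    field_simp
  -- The bound `log q ≥ 1/5` absorbs constants: `I < 3 + 2 log q ≤ 17 log q`. It is here that `ε`
  -- must stay away from `ρD`.
  · have hl : 1 / 5 ≤ Real.log q := by
      have h1 := Real.one_sub_inv_le_log_of_pos (show 0 < q by linarith)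
      have h2 : q⁻¹ ≤ (5 / 4)⁻¹ := inv_anti₀ (by norm_num) hq54
      norm_num at h2
      linarith
    have hlog2 : 1 / 2 ≤ Real.log 2 := by linarith [Real.log_two_gt_d9]
    have h3 : Real.logb 2 (3 / 4 + q) ≤ 2 * (1 + Real.log q) := by
      have h4 : Real.log (3 / 4 + q) ≤ 1 + Real.log q := by
        have h5 : 3 / 4 + q ≤ 2 * q := by linarith
        have h6 := Real.log_le_log hq34 h5
        rw [Real.log_mul two_ne_zero (by linarith)] at h6
        linarith [Real.log_two_lt_d9]
      rw [Real.logb, div_le_iff₀ (by linarith)]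
      nlinarith
    linarith

end Final

end GradReg

/-! ### Assembly of the convergence and complexity bounds. -/

theorem mainTheorem1 :
    ∃ C : ℝ, 0 < C ∧ ∀ L D ρ : ℝ, 0 ≤ L → 0 < D → 0 < ρ →
      -- convergence guarantee
      (∀ (d : ℕ) (S Ω : Type*) [MeasurableSpace S] [MeasurableSpace Ω]
        (P : Measure S) [IsProbabilityMeasure P] (Pr : Measure Ω) [IsProbabilityMeasure Pr]
        (X U : Set (EuclideanSpace ℝ (Fin d))) (g : EuclideanSpace ℝ (Fin d) → ℝ)
        (G : EuclideanSpace ℝ (Fin d) → S → EuclideanSpace ℝ (Fin d)) (ξ : ℕ → Ω → S)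
        (xc : EuclideanSpace ℝ (Fin d)),
        GradReg.StandingAssumptions X g P U G L D Pr ξ → xc ∈ X →
        -- the Moreau envelope is finite and differentiable, so that its gradient is meaningful
        (∀ x, GradReg.moreauEnvelope (GradReg.objective X g) (1 / (2 * ρ)) x ≠ ⊤ ∧
          GradReg.moreauEnvelope (GradReg.objective X g) (1 / (2 * ρ)) x ≠ ⊥) ∧
        Differentiable ℝ (GradReg.moreauReal (GradReg.objective X g) (1 / (2 * ρ))) ∧
        ∀ (ε : ℝ) (I T : ℕ), 0 < ε → ε ≤ 2 * ρ * D →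
          (I : ℝ) = Real.logb 2 (3 / 4 + ρ * D / ε) → 0 < T →
          ∀ z : Ω → GradReg.RunState (EuclideanSpace ℝ (Fin d)),
          (∀ ω, z ω = GradReg.convexGradualReg X (fun n => ξ n ω) xc
            (ε / (2 * D)) (2 * ρ - ε / (2 * D)) T I G) →
          (∀ ω, (z ω).point ∈ X) ∧
            Integrable (fun ω => GradReg.stationarity ρ X g (z ω).point) Pr ∧
          ∫ ω, GradReg.stationarity ρ X g (z ω).point ∂Pr ≤
            28 * Real.sqrt 2 * Real.logb 2 (3 / 4 + ρ * D / ε) *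
              Real.sqrt (2 * L ^ 2 + 3 * ρ ^ 2 * D ^ 2) / Real.sqrt ((T : ℝ) + 1) + ε / 2) ∧
      -- complexity: the parameters depend only on `L, D, ρ, ε`, and `ε' = ε` whenever
      -- `log₂ (3/4 + ρ D / ε)` is an integer
      (∀ ε : ℝ, 0 < ε → ε ≤ 4 / 5 * (ρ * D) →
        ∃ (ε' : ℝ) (I T : ℕ), 0 < ε' ∧ ε' ≤ ε ∧
          (I : ℝ) = Real.logb 2 (3 / 4 + ρ * D / ε') ∧
          ((∃ n : ℕ, (n : ℝ) = Real.logb 2 (3 / 4 + ρ * D / ε)) → ε' = ε) ∧ 0 < T ∧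
          ∀ (d : ℕ) (S Ω : Type*) [MeasurableSpace S] [MeasurableSpace Ω]
            (P : Measure S) [IsProbabilityMeasure P] (Pr : Measure Ω) [IsProbabilityMeasure Pr]
            (X U : Set (EuclideanSpace ℝ (Fin d))) (g : EuclideanSpace ℝ (Fin d) → ℝ)
            (G : EuclideanSpace ℝ (Fin d) → S → EuclideanSpace ℝ (Fin d)) (ξ : ℕ → Ω → S)
            (xc : EuclideanSpace ℝ (Fin d)),
            GradReg.StandingAssumptions X g P U G L D Pr ξ → xc ∈ X →
            ∀ z : Ω → GradReg.RunState (EuclideanSpace ℝ (Fin d)),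
            (∀ ω, z ω = GradReg.convexGradualReg X (fun n => ξ n ω) xc
              (ε' / (2 * D)) (2 * ρ - ε' / (2 * D)) T I G) →
            (∀ ω, (((z ω).oracleCalls + (z ω).projCalls : ℕ) : ℝ) ≤
              C * (Real.log (ρ * D / ε) ^ 3 * (L ^ 2 + ρ ^ 2 * D ^ 2) / ε ^ 2)) ∧
            (∀ ω, (z ω).point ∈ X) ∧
            Integrable (fun ω => GradReg.stationarity ρ X g (z ω).point) Pr ∧
            ∫ ω, GradReg.stationarity ρ X g (z ω).point ∂Pr ≤ ε) := by
  refine ⟨25088 * 24 ^ 3 * 3, by norm_num, fun L D ρ _ hD hρ => ⟨?_, fun ε hε hεD => ?_⟩⟩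
  · intro d S Ω _ _ P _ Pr _ X U g G ξ xc A hxc
    obtain ⟨h1, h2⟩ := A.moreau_finite_differentiable ⟨xc, hxc⟩ hρ
    refine ⟨h1, h2, fun ε I T hε hεD hI hT z hz => ?_⟩
    rw [← hI]
    exact A.integral_stationarity_le_of_two_pow hD hρ hxc hε hεD
      (GradReg.two_pow_eq_of_logb (by positivity) hI) hT hz
  · obtain ⟨ε', I, hε', hle, hI, hint, hlog⟩ :=
      GradReg.exists_admissible_accuracy hD hρ hε hεD
    have hρD : 0 < ρ * D := by positivity
    have hεD' : ε' ≤ 2 * ρ * D := by linarith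
    have hpow := GradReg.two_pow_eq_of_logb (by positivity) hI
    have hI0 := GradReg.round_count_pos hε' hεD' hpow
    have hI1 : (1 : ℝ) ≤ I := Nat.one_le_cast.2 hI0
    obtain ⟨B, hB⟩ : ∃ B, B = 2 * L ^ 2 + 3 * ρ ^ 2 * D ^ 2 := ⟨_, rfl⟩
    have hB0 : 0 < B := by rw [hB]; positivity
    -- Here `1568 = (28√2)²`, and the factor `4` brings the stochastic error down to `ε / 2`.
    obtain ⟨x, hx⟩ : ∃ x, x = 4 * 1568 * (I : ℝ) ^ 2 * B / ε ^ 2 := ⟨_, rfl⟩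
    have hx0 : 0 < x := by rw [hx]; positivity
    have hxT : x ≤ ⌈x⌉₊ := Nat.le_ceil x
    refine ⟨ε', I, ⌈x⌉₊, hε', hle, hI, hint, Nat.ceil_pos.2 hx0, ?_⟩
    intro d S Ω _ _ P _ Pr _ X U g G ξ xc A hxc z hz
    obtain ⟨h1, h2, h3⟩ := A.integral_stationarity_le_of_two_pow hD hρ hxc hε' hεD' hpow
      (Nat.ceil_pos.2 hx0) hz
    refine ⟨fun ω => ?_, h1, h2, h3.trans ?_⟩
    · rw [hz ω, GradReg.oracleCalls_add_projCalls_convexGradualReg]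
      -- Each round makes only `T - 1` calls of each kind, so rounding `x` up costs nothing.
      have hTx : ((⌈x⌉₊ - 1 : ℕ) : ℝ) ≤ x := by
        rw [Nat.cast_pred (Nat.ceil_pos.2 hx0)]
        linarith [Nat.ceil_lt_add_one hx0.le]
      push_cast
      calc 2 * (((I : ℝ) + 1) * ((⌈x⌉₊ - 1 : ℕ) : ℝ)) ≤ 2 * ((I + I) * x) := by gcongr
        _ = 25088 * (I : ℝ) ^ 3 * B / ε ^ 2 := by rw [hx]; ring
        _ ≤ 25088 * (24 * Real.log (ρ * D / ε)) ^ 3 * (3 * (L ^ 2 + ρ ^ 2 * D ^ 2)) / ε ^ 2 := by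
            have hlog0 : 0 ≤ 24 * Real.log (ρ * D / ε) := (Nat.cast_nonneg I).trans hlog
            have hB3 : B ≤ 3 * (L ^ 2 + ρ ^ 2 * D ^ 2) := by
              rw [hB]; nlinarith [sq_nonneg L]
            gcongr
        _ = _ := by ring
    · rw [← hB]
      have h4 : 28 * √2 * I * √B / √((⌈x⌉₊ : ℝ) + 1) ≤ ε / 2 := by
        rw [div_le_iff₀ (by positivity)]
        refine le_of_sq_le_sq ?_ (by positivity)
        rw [mul_pow, mul_pow, mul_pow, mul_pow, Real.sq_sqrt (by positivity),
          Real.sq_sqrt (by positivity), Real.sq_sqrt (by positivity)]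
        have h5 : x * ε ^ 2 = 4 * 1568 * (I : ℝ) ^ 2 * B := by rw [hx]; field_simp
        nlinarith [sq_nonneg ε]
      linarith
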